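/- **Setting.** Let $\mathcal V=\mathcal V_g\cup\mathcal V_l$ be the $n=n_g+n_l$ buses (generators, loads) of a connected undirected graph with neighbour sets $\mathcal N_i$ and edge set $\mathcal E$, with line parameters $B_{ij}=B_{ji}\in\mathbb R$, shunts $\hat B_{ii}\ge 0$, $B_{ii}=\sum_{j\in\mathcal N_i}B_{ij}+\hat B_{ii}$, damping $A_i>0$ ($i\in\mathcal V$), and $M_i>0$, $T_i>0$, $X_{di}>X_{di}'$, $E_{fi}\in\mathbb R$ ($i\in\mathcal V_g$), and constant reactive demands $\bar Q_{li}\ge 0$ ($i\in\mathcal V_l$). Let $\hat D\in\mathbb R^{n\times(n-1)}$ have full column rank and $\ker\hat D^T=\mathrm{span}\{\mathbb 1_n\}$; put $\varphi=\hat D^T\delta$, so that the angle differences $\delta_{ij}=\delta_i-\delta_j$ are functions of $\varphi$. Let $C:\mathbb R^{n_g}\to\mathbb R$ be strictly convex, $U:\mathbb R^{n_l}\to\mathbb R$ strictly concave, both twice continuously differentiable, $D_c\in\mathbb R^{n\times m_c}$, and let $\tau_g,\tau_l,\tau_v,\tau_{\lambda_g},\tau_{\lambda_l}$ be symmetric positive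 definite matrices, $\tau_c$ their block-diagonal sum. Subscripts $g,l$ on $\hat D,D_c$ denote the generator and load rows, $A_g=\mathrm{diag}(A_i)_{i\in\mathcal V_g}$, $A_l=\mathrm{diag}(A_i)_{i\in\mathcal V_l}$, $R_g=\mathrm{diag}((X_{di}-X_{di}')/T_i)$, and $[E_l]=\mathrm{diag}(E_i)_{i\in\mathcal V_l}$. The state is $x=\mathrm{col}(x_c,x_p)$ with $x_p=\mathrm{col}(\varphi,p_g,E_g,E_l)$, all $E_i>0$, and $x_c=\tau_c z_c$, $z_c=\mathrm{col}(P_g,P_l,v,\lambda_g,\lambda_l)$. Put $\omega_i=M_i^{-1}p_i$ for $i\in\mathcal V_g$, $S(z_c)=U(P_l)-C(P_g)$, $H_c=\frac12x_c^T\tau_c^{-1}x_c$, and $$H_p=\tfrac12\sum_{i\in\mathcal V_g}\Big(M_i^{-1}p_i^2+\tfrac{(E_i-E_{fi})^2}{X_{di}-X_{di}'}\Big)+\tfrac12\sum_{i\in\mathcal V}B_{ii}E_i^2-\sum_{(i,j)\in\mathcal E}B_{ij}E_iE_j\cos\delta_{ij}.$$ The closed-loop system of power network and dynamic pricing algorithm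 is $$\begin{aligned} \tau_g\dot P_g&=-\nabla C(P_g)+\lambda_g-\omega_g, & \tau_l\dot P_l&=\nabla U(P_l)-\lambda_l+\omega_l, & \tau_v\dot v&=-D_{cg}^T\lambda_g-D_{cl}^T\lambda_l,\\ \tau_{\lambda_g}\dot\lambda_g&=D_{cg}v-P_g, & \tau_{\lambda_l}\dot\lambda_l&=D_{cl}v+P_l, & \dot\varphi&=\hat D_g^T\omega_g+\hat D_l^T\omega_l,\\ \dot p_g&=-\hat D_g\nabla_\varphi H_p-A_g\omega_g+P_g, & \dot E_g&=-R_g\nabla_{E_g}H_p, & &\\ 0&=-[E_l]\nabla_{E_l}H_p+\bar Q_l, & 0&=-\hat D_l\nabla_\varphi H_p-A_l\omega_l-P_l. & & \end{aligned}\tag{1}$$ Given an equilibrium $(\bar x,\bar\omega_l)$ of (1), put $\bar H_p(x)=H_p(x)-(x-\bar x)^T\nabla H_p(\bar x)-H_p(\bar x)$, likewise $\bar H_c$, $\bar H_a(x)=E_l^T\nabla_{E_l}H_p(\bar x)-\bar Q_l^T\log E_l$ (elementwise logarithm), and $\bar H=\bar H_p+\bar H_a+\bar H_c$. After elimination of $\omega_l$,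 (1) takes the shifted port-Hamiltonian form $$\begin{bmatrix}\dot x_c\\\dot\varphi\\\dot p_g\\\dot E_g\\0\end{bmatrix}= \begin{bmatrix}J_c-G_2A_l^{-1}G_2^T&-G_2A_l^{-1}\hat D_l&-G_1&0&0\\-\hat D_l^TA_l^{-1}G_2^T&-\hat D_l^TA_l^{-1}\hat D_l&\hat D_g^T&0&0\\G_1^T&-\hat D_g&-A_g&0&0\\0&0&0&-R_g&0\\0&0&0&0&-[E_l]\end{bmatrix}\nabla\bar H(x)+\begin{bmatrix}\nabla S(\tau_c^{-1}x_c)-\nabla S(\tau_c^{-1}\bar x_c)\\0\\0\\0\\0\end{bmatrix},\tag{2}$$ where $G_1^T=[I\ 0\ 0\ 0\ 0]$, $G_2^T=[0\ I\ 0\ 0\ 0]$ select the $P_g$- and $P_l$-blocks and $$J_c=\begin{bmatrix}0&0&0&I&0\\0&0&0&0&-I\\0&0&0&-D_{cg}^T&-D_{cl}^T\\-I&0&D_{cg}&0&0\\0&I&D_{cl}&0&0\end{bmatrix}.$$ **Theorem 2.** Suppose that $m_c=n-1$ and $D_c$ is the incidence matrix of a tree on $\mathcal V$, and that the closed-loop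 system has an equilibrium $(\bar x,\bar\omega_l)$ with $\nabla^2\bar H(\bar x)>0$. Then $\bar x$ is a locally asymptotically stable equilibrium of (2): from every consistent initial state near $\bar x$ there is a unique solution of (2), it exists for all $t\ge0$, and $\bar x$ is Lyapunov stable and locally attractive for these solutions. Moreover the frequency deviations vanish at the equilibrium, $\bar\omega_g=0$ and $\bar\omega_l=0$, and $(\bar P_g,\bar P_l,\bar v,\bar\lambda_g,\bar\lambda_l)=\tau_c^{-1}\bar x_c$ satisfies the KKT conditions of the problem of maximizing $U(P_l)-C(P_g)$ subject to $-D_cv+\mathrm{col}(P_g,-P_l)=0$: $$\nabla C(\bar P_g)=\bar\lambda_g,\quad \nabla U(\bar P_l)=\bar\lambda_l,\quad D_{cg}^T\bar\lambda_g+D_{cl}^T\bar\lambda_l=0,\quad D_{cg}\bar v=\bar P_g,\quad D_{cl}\bar v=-\bar P_l.$$ -/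

import Mathlib

open Matrix Set Filter Topology

noncomputable section

/-! ### Gradients, Hessians, shifted functions -/

/-- The gradient `∇F(x)`, as the column of partial derivatives. -/
def grad {ι : Type} [Fintype ι] [DecidableEq ι] (F : (ι → ℝ) → ℝ) (x : ι → ℝ) : ι → ℝ :=
  fun i => fderiv ℝ F x (Pi.single i 1)

/-- The Hessian `∇²F(x)`, as the matrix of second partial derivatives. -/
def hess {ι : Type} [Fintype ι] [DecidableEq ι] (F : (ι → ℝ) → ℝ) (x : ι → ℝ) :
    Matrix ι ι ℝ :=
  Matrix.of fun i j => fderiv ℝ (fun y => grad F y j) x (Pi.single i 1)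

/-- The shifted function `F(x) - (x - x̄)ᵀ ∇F(x̄) - F(x̄)`. -/
def shifted {ι : Type} [Fintype ι] [DecidableEq ι] (F : (ι → ℝ) → ℝ) (xbar x : ι → ℝ) : ℝ :=
  F x - (x - xbar) ⬝ᵥ grad F xbar - F xbar

/-! ### Differential-algebraic equations -/

/-- A semi-explicit differential-algebraic system `ẋ = f(x, y)`, `0 = g(x, y)` on a set `dom` of
admissible states; `ι` indexes the differential variables `x`, `κ` the algebraic variables `y`. -/
structure DAE (ι κ : Type) where
  dom : Set (ι ⊕ κ → ℝ)
  f : (ι ⊕ κ → ℝ) → ι → ℝ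
  g : (ι ⊕ κ → ℝ) → κ → ℝ

namespace DAE

variable {ι κ : Type}

/-- Equilibria: admissible states where both right-hand sides vanish. -/
def IsEquilibrium (S : DAE ι κ) (x : ι ⊕ κ → ℝ) : Prop :=
  x ∈ S.dom ∧ S.f x = 0 ∧ S.g x = 0

/-- Consistent initial states. -/
def consistent (S : DAE ι κ) : Set (ι ⊕ κ → ℝ) := {x | x ∈ S.dom ∧ S.g x = 0}

/-- `x` is a (classical) solution on `J`: a continuous curve of admissible states whose
differential variables satisfy the differential equation and which satisfies the algebraic
equation. -/
structure IsSolutionOn (S : DAE ι κ) (J : Set ℝ) (x : ℝ → ι ⊕ κ → ℝ) : Prop where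
  continuousOn : ContinuousOn x J
  mem_dom : ∀ t ∈ J, x t ∈ S.dom
  differential : ∀ t ∈ J, ∀ i, HasDerivWithinAt (fun s => x s (Sum.inl i)) (S.f (x t) i) J t
  algebraic : ∀ t ∈ J, S.g (x t) = 0

/-- Local asymptotic stability of an equilibrium of a differential-algebraic system: from every
consistent initial state near the equilibrium there is a solution for all `t ≥ 0`, unique on every
interval of existence; and the equilibrium is Lyapunov stable and locally attractive. -/
structure LocallyAsymptoticallyStable [Fintype ι] [Fintype κ] (S : DAE ι κ)
    (xbar : ι ⊕ κ → ℝ) : Prop where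
  equilibrium : S.IsEquilibrium xbar
  wellPosed : ∃ r > 0, ∀ x₀ ∈ S.consistent, dist x₀ xbar < r →
    ∃ x : ℝ → ι ⊕ κ → ℝ, S.IsSolutionOn (Ici 0) x ∧ x 0 = x₀ ∧
      ∀ (J : Set ℝ) (y : ℝ → ι ⊕ κ → ℝ), J ⊆ Ici 0 → J.OrdConnected → (0 : ℝ) ∈ J →
        S.IsSolutionOn J y → y 0 = x₀ → EqOn y x J
  stable : ∀ ε > 0, ∃ δ > 0, ∀ x : ℝ → ι ⊕ κ → ℝ, S.IsSolutionOn (Ici 0) x →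
    dist (x 0) xbar < δ → ∀ t ≥ 0, dist (x t) xbar < ε
  attractive : ∃ δ > 0, ∀ x : ℝ → ι ⊕ κ → ℝ, S.IsSolutionOn (Ici 0) x →
    dist (x 0) xbar < δ → Tendsto x atTop (𝓝 xbar)

end DAE

/-! ### Incidence matrix of a tree -/

/-- `D` is the incidence matrix of a tree with node set `V` whose edges are enumerated by `K` and
arbitrarily oriented: column `k` has `+1` at the head of edge `k`, `-1` at its tail, `0` elsewhere. -/
def IsTreeIncidence {V K : Type} [DecidableEq V] (D : Matrix V K ℝ) : Prop :=
  ∃ (T : SimpleGraph V) (tail head : K → V), T.IsTree ∧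
    BijOn (fun k => s(tail k, head k)) univ T.edgeSet ∧
    ∀ i k, D i k = (if i = head k then 1 else 0) - (if i = tail k then 1 else 0)

/-! ### Index sets -/

/-- Buses: generator nodes, then load nodes. -/
abbrev Bus (ng nl : ℕ) : Type := Fin ng ⊕ Fin nl

/-- Index set of the controller state `x_c = col(x_g, x_l, x_v, x_λg, x_λl)`. -/
abbrev CIdx (ng nl mc : ℕ) : Type := Fin ng ⊕ (Fin nl ⊕ (Fin mc ⊕ (Fin ng ⊕ Fin nl)))

/-- Index set of the differential variables `col(x_c, φ, p_g, E_g)`. -/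
abbrev DIdx (ng nl mc : ℕ) : Type :=
  CIdx ng nl mc ⊕ (Fin (ng + nl - 1) ⊕ (Fin ng ⊕ Fin ng))

/-- Index set of the full state `x = col(x_c, φ, p_g, E_g, E_l)`. -/
abbrev XIdx (ng nl mc : ℕ) : Type := DIdx ng nl mc ⊕ Fin nl

/-- States `x = col(x_c, φ, p_g, E_g, E_l)`. -/
abbrev State (ng nl mc : ℕ) : Type := XIdx ng nl mc → ℝ

section Blocks

variable {ng nl mc : ℕ}

/-! Blocks of a vector indexed like `x_c`. -/

def cG (w : CIdx ng nl mc → ℝ) : Fin ng → ℝ := fun i => w (.inl i)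
def cL (w : CIdx ng nl mc → ℝ) : Fin nl → ℝ := fun i => w (.inr (.inl i))
def cV (w : CIdx ng nl mc → ℝ) : Fin mc → ℝ := fun k => w (.inr (.inr (.inl k)))
def cLamG (w : CIdx ng nl mc → ℝ) : Fin ng → ℝ := fun i => w (.inr (.inr (.inr (.inl i))))
def cLamL (w : CIdx ng nl mc → ℝ) : Fin nl → ℝ := fun i => w (.inr (.inr (.inr (.inr i))))

/-! Blocks of a vector indexed like `x` (a state or a gradient). -/

def xC (w : State ng nl mc) : CIdx ng nl mc → ℝ := fun i => w (.inl (.inl i))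
def xPhi (w : State ng nl mc) : Fin (ng + nl - 1) → ℝ := fun k => w (.inl (.inr (.inl k)))
def xP (w : State ng nl mc) : Fin ng → ℝ := fun i => w (.inl (.inr (.inr (.inl i))))
def xEg (w : State ng nl mc) : Fin ng → ℝ := fun i => w (.inl (.inr (.inr (.inr i))))
def xEl (w : State ng nl mc) : Fin nl → ℝ := fun i => w (.inr i)

/-- The voltages `E_i` at all buses. -/
def xE (w : State ng nl mc) : Bus ng nl → ℝ := Sum.elim (xEg w) (xEl w)

/-- `col(a, b, c, d, e)` as a vector indexed like `x_c`. -/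
def colC (a : Fin ng → ℝ) (b : Fin nl → ℝ) (c : Fin mc → ℝ) (d : Fin ng → ℝ) (e : Fin nl → ℝ) :
    CIdx ng nl mc → ℝ :=
  Sum.elim a (Sum.elim b (Sum.elim c (Sum.elim d e)))

/-- `col(c, φ, p, E_g)` as a vector indexed like the differential variables. -/
def colD (c : CIdx ng nl mc → ℝ) (φ : Fin (ng + nl - 1) → ℝ) (p Eg : Fin ng → ℝ) :
    DIdx ng nl mc → ℝ :=
  Sum.elim c (Sum.elim φ (Sum.elim p Eg))

end Blocks

/-! ### The model -/

/-- Data of a power network with `ng` generators and `nl` loads and of a dynamic pricing algorithm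
on a communication graph with `mc` edges. -/
structure Model (ng nl mc : ℕ) where
  /-- transmission network -/
  graph : SimpleGraph (Bus ng nl)
  /-- negatives of the line susceptances `B_ij` (only the values on lines are used) -/
  B : Bus ng nl → Bus ng nl → ℝ
  /-- negatives of the shunt susceptances -/
  Bhat : Bus ng nl → ℝ
  /-- damping constants -/
  A : Bus ng nl → ℝ
  /-- moments of inertia -/
  M : Fin ng → ℝ
  /-- open-circuit transient time constants -/
  T : Fin ng → ℝ
  /-- synchronous reactances -/
  Xd : Fin ng → ℝ
  /-- transient reactances -/
  Xd' : Fin ng → ℝ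
  /-- excitation voltages -/
  Ef : Fin ng → ℝ
  /-- reactive power demands -/
  Q : Fin nl → ℝ
  /-- matrix of the change of angle coordinates `φ = D̂ᵀ δ` -/
  Dhat : Matrix (Bus ng nl) (Fin (ng + nl - 1)) ℝ
  /-- incidence matrix of the communication graph -/
  Dc : Matrix (Bus ng nl) (Fin mc) ℝ
  /-- generation cost -/
  C : (Fin ng → ℝ) → ℝ
  /-- consumption utility -/
  U : (Fin nl → ℝ) → ℝ
  τg : Matrix (Fin ng) (Fin ng) ℝ
  τl : Matrix (Fin nl) (Fin nl) ℝ
  τv : Matrix (Fin mc) (Fin mc) ℝ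
  τlamg : Matrix (Fin ng) (Fin ng) ℝ
  τlaml : Matrix (Fin nl) (Fin nl) ℝ

namespace Model

variable {ng nl mc : ℕ} (S : Model ng nl mc)

/-- Standing assumptions on the data. -/
structure Standing : Prop where
  connected : S.graph.Connected
  B_symm : ∀ i j, S.B i j = S.B j i
  Bhat_nonneg : ∀ i, 0 ≤ S.Bhat i
  A_pos : ∀ i, 0 < S.A i
  M_pos : ∀ i, 0 < S.M i
  T_pos : ∀ i, 0 < S.T i
  Xd_gt : ∀ i, S.Xd' i < S.Xd i
  Q_nonneg : ∀ i, 0 ≤ S.Q i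
  Dhat_rank : S.Dhat.rank = ng + nl - 1
  Dhat_ker : LinearMap.ker (S.Dhatᵀ).mulVecLin = Submodule.span ℝ {fun _ => (1 : ℝ)}
  C_smooth : ContDiff ℝ 2 S.C
  U_smooth : ContDiff ℝ 2 S.U
  C_convex : StrictConvexOn ℝ univ S.C
  U_concave : StrictConcaveOn ℝ univ S.U
  τg_pos : S.τg.PosDef
  τl_pos : S.τl.PosDef
  τv_pos : S.τv.PosDef
  τlamg_pos : S.τlamg.PosDef
  τlaml_pos : S.τlaml.PosDef

/-- `B_ii = ∑_{j ∈ N_i} B_ij + B̂_ii`. -/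
def Bself (i : Bus ng nl) : ℝ :=
  open Classical in (∑ j with S.graph.Adj i j, S.B i j) + S.Bhat i

/-- An angle vector `δ` with `D̂ᵀ δ = φ`. It is unique up to a common rotation of all angles, on
which the differences `δ_i - δ_j` do not depend. -/
def angle (φ : Fin (ng + nl - 1) → ℝ) : Bus ng nl → ℝ :=
  S.Dhat *ᵥ ((S.Dhatᵀ * S.Dhat)⁻¹ *ᵥ φ)

/-- Energy `H_p` of the generators and the transmission network. Every (undirected) line occurs
twice in the double sum over neighbours, hence the factor `1/2` in front of it. -/
def Hp (x : State ng nl mc) : ℝ :=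
  open Classical in
  1 / 2 * ∑ i, ((S.M i)⁻¹ * xP x i ^ 2 + (xEg x i - S.Ef i) ^ 2 / (S.Xd i - S.Xd' i))
  + 1 / 2 * ∑ i, S.Bself i * xE x i ^ 2
  - 1 / 2 * ∑ i, ∑ j with S.graph.Adj i j, S.B i j * xE x i * xE x j *
      Real.cos (S.angle (xPhi x) i - S.angle (xPhi x) j)

/-- The block-diagonal matrix `τ_c`. -/
def τc : Matrix (CIdx ng nl mc) (CIdx ng nl mc) ℝ :=
  fromBlocks S.τg 0 0 (fromBlocks S.τl 0 0 (fromBlocks S.τv 0 0 (fromBlocks S.τlamg 0 0 S.τlaml)))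

/-- `z_c = τ_c⁻¹ x_c = col(P_g, P_l, v, λ_g, λ_l)`. -/
def zc (x : State ng nl mc) : CIdx ng nl mc → ℝ := (S.τc)⁻¹ *ᵥ xC x

/-- Controller Hamiltonian `H_c = ½ x_cᵀ τ_c⁻¹ x_c`. -/
def Hc (x : State ng nl mc) : ℝ := 1 / 2 * (xC x ⬝ᵥ ((S.τc)⁻¹ *ᵥ xC x))

/-- Social welfare `U(P_l) - C(P_g)`, as a function of `z_c`. -/
def welfare (z : CIdx ng nl mc → ℝ) : ℝ := S.U (cL z) - S.C (cG z)

/-- The product `J_c w`, where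
`J_c = [0 0 0 I 0; 0 0 0 0 -I; 0 0 0 -D_cgᵀ -D_clᵀ; -I 0 D_cg 0 0; 0 I D_cl 0 0]`. -/
def Jc (w : CIdx ng nl mc → ℝ) : CIdx ng nl mc → ℝ :=
  colC (cLamG w) (-cLamL w)
    (-(S.Dc.toRows₁ᵀ *ᵥ cLamG w) - S.Dc.toRows₂ᵀ *ᵥ cLamL w)
    (-cG w + S.Dc.toRows₁ *ᵥ cV w)
    (cL w + S.Dc.toRows₂ *ᵥ cV w)

def Ag : Matrix (Fin ng) (Fin ng) ℝ := diagonal fun i => S.A (.inl i)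

def Al : Matrix (Fin nl) (Fin nl) ℝ := diagonal fun i => S.A (.inr i)

def Rg : Matrix (Fin ng) (Fin ng) ℝ := diagonal fun i => (S.Xd i - S.Xd' i) / S.T i

/-- Frequency deviations `ω_g = M⁻¹ p_g` at the generators. -/
def omegaG (x : State ng nl mc) : Fin ng → ℝ := fun i => (S.M i)⁻¹ * xP x i

/-! ### The closed-loop system -/

/-- State `(x, ω_l)` of the closed-loop system before elimination of the load frequencies. -/
def join (x : State ng nl mc) (ωl : Fin nl → ℝ) : DIdx ng nl mc ⊕ (Fin nl ⊕ Fin nl) → ℝ :=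
  Sum.elim (fun i => x (.inl i)) (Sum.elim (xEl x) ωl)

/-- The `x`-part of `(x, ω_l)`. -/
def statePart (y : DIdx ng nl mc ⊕ (Fin nl ⊕ Fin nl) → ℝ) : State ng nl mc :=
  Sum.elim (fun i => y (.inl i)) (fun i => y (.inr (.inl i)))

/-- The `ω_l`-part of `(x, ω_l)`. -/
def freqPart (y : DIdx ng nl mc ⊕ (Fin nl ⊕ Fin nl) → ℝ) : Fin nl → ℝ :=
  fun i => y (.inr (.inr i))

/-- The interconnection of the power network with the pricing algorithm, as a
differential-algebraic system with algebraic variables `E_l` and `ω_l`, on the set of states with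
positive voltages. Here `h = ∇(H_p + H_c)`, and `ω_l` is the gradient of `U_p(ω_l) = ½ ω_lᵀ ω_l`. -/
def closedLoop : DAE (DIdx ng nl mc) (Fin nl ⊕ Fin nl) where
  dom := {y | ∀ i, 0 < xE (statePart y) i}
  f := fun y =>
    let x := statePart y
    let ωl := freqPart y
    let h := grad (fun x => S.Hp x + S.Hc x) x
    colD
      (S.Jc (xC h) + colC (-xP h) ωl 0 0 0 + grad S.welfare (S.zc x))
      (S.Dhat.toRows₁ᵀ *ᵥ xP h + S.Dhat.toRows₂ᵀ *ᵥ ωl)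
      (cG (xC h) - S.Dhat.toRows₁ *ᵥ xPhi h - S.Ag *ᵥ xP h)
      (-(S.Rg *ᵥ xEg h))
  g := fun y =>
    let x := statePart y
    let ωl := freqPart y
    let h := grad (fun x => S.Hp x + S.Hc x) x
    Sum.elim
      (-(diagonal (xEl x) *ᵥ xEl h) + S.Q)
      (-cL (xC h) - S.Dhat.toRows₂ *ᵥ xPhi h - S.Al *ᵥ ωl)

/-- `H̄_a(x) = E_lᵀ ∇_{E_l} H_p(x̄) - Q̄_lᵀ log E_l`. -/
def Habar (xbar x : State ng nl mc) : ℝ :=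
  xEl x ⬝ᵥ xEl (grad S.Hp xbar) - S.Q ⬝ᵥ fun i => Real.log (xEl x i)

/-- Shifted Hamiltonian `H̄ = H̄_p + H̄_a + H̄_c`. -/
def Hbar (xbar x : State ng nl mc) : ℝ :=
  shifted S.Hp xbar x + S.Habar xbar x + shifted S.Hc xbar x

/-- The closed-loop system in shifted port-Hamiltonian form after elimination of `ω_l`, on the set
of states with positive voltages. Here `h = ∇H̄(x)`. -/
def shiftedSystem (xbar : State ng nl mc) : DAE (DIdx ng nl mc) (Fin nl) where
  dom := {x | ∀ i, 0 < xE x i}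
  f := fun x =>
    let h := grad (S.Hbar xbar) x
    colD
      (S.Jc (xC h)
        + colC (-xP h)
            (-((S.Al)⁻¹ *ᵥ cL (xC h)) - (S.Al)⁻¹ *ᵥ (S.Dhat.toRows₂ *ᵥ xPhi h)) 0 0 0
        + (grad S.welfare (S.zc x) - grad S.welfare (S.zc xbar)))
      (-(S.Dhat.toRows₂ᵀ *ᵥ ((S.Al)⁻¹ *ᵥ cL (xC h)))
        - S.Dhat.toRows₂ᵀ *ᵥ ((S.Al)⁻¹ *ᵥ (S.Dhat.toRows₂ *ᵥ xPhi h))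
        + S.Dhat.toRows₁ᵀ *ᵥ xP h)
      (cG (xC h) - S.Dhat.toRows₁ *ᵥ xPhi h - S.Ag *ᵥ xP h)
      (-(S.Rg *ᵥ xEg h))
  g := fun x => -(diagonal (xEl x) *ᵥ xEl (grad (S.Hbar xbar) x))

/-- Karush-Kuhn-Tucker conditions of the social welfare problem: maximize `U(P_l) - C(P_g)` over
`(P_g, P_l, v)` subject to `-D_c v + col(P_g, -P_l) = 0`, with multipliers `(λ_g, λ_l)`. -/
structure KKT (Pg : Fin ng → ℝ) (Pl : Fin nl → ℝ) (v : Fin mc → ℝ)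
    (lamg : Fin ng → ℝ) (laml : Fin nl → ℝ) : Prop where
  cost : grad S.C Pg - lamg = 0
  utility : -grad S.U Pl + laml = 0
  price : S.Dc.toRows₁ᵀ *ᵥ lamg + S.Dc.toRows₂ᵀ *ᵥ laml = 0
  balance_g : -(S.Dc.toRows₁ *ᵥ v) + Pg = 0
  balance_l : -(S.Dc.toRows₂ *ᵥ v) - Pl = 0

end Model

end

/-!
The shifted Hamiltonian `H̄` is a Lyapunov function. Near `x̄` it is strictly convex, and for
positive voltages the algebraic equations of (2) say that its partial derivatives in the algebraic
variables `E_l` vanish. Consequently `E_l` minimizes `H̄` for given differential variables, which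
makes it a Lipschitz function of them and turns (2) into a locally Lipschitz ordinary differential
equation. Along its solutions `H̄` decreases, because of the damping, the strict convexity of `C`
and the strict concavity of `U`; thus solutions that start near `x̄` stay in a compact
neighbourhood, and LaSalle's invariance principle applies.

On a solution along which `H̄` is constant, `P_g`, `P_l` and `ω` keep their equilibrium values. The
remaining equations then make the deviations of `λ_g`, `λ_l` and of `D_c v` vanish, and the
injectivity of `D_c` and `D̂` leaves only `∇H̄ = 0`, which near `x̄` holds at `x̄` alone.

At an equilibrium the angle equation gives `ω ∈ ker D̂ᵀ = span {1}`, so `D_cᵀ ω = 0` as well.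
Pairing the power balance `D_c v = D̂ ∇_φ H_p + A ω` with `ω` yields `∑ A_i ω_i² = 0`, and with
`ω = 0` the equations of the pricing algorithm are the KKT conditions.
-/

noncomputable section

/-! ### Gradients and convexity -/

theorem strictConvexOn_comp_add_smul {E : Type*} [AddCommGroup E] [Module ℝ E] {F : E → ℝ}
    (hF : StrictConvexOn ℝ univ F) (x : E) {v : E} (hv : v ≠ 0) :
    StrictConvexOn ℝ univ fun t : ℝ => F (x + t • v) := by
  refine ⟨convex_univ, fun s _ t _ hst a b ha hb hab => ?_⟩
  have hne : x + s • v ≠ x + t • v := fun h => hst (smul_left_injective ℝ hv (add_left_cancel h))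
  have hcomb : x + (a • s + b • t) • v = a • (x + s • v) + b • (x + t • v) := by
    rw [smul_add, smul_add, add_add_add_comm, ← add_smul, hab, one_smul, add_smul, smul_assoc,
      smul_assoc]
  simpa only [hcomb] using hF.2 (mem_univ _) (mem_univ _) hne ha hb hab

section Grad

variable {ι κ : Type} [Fintype ι] [DecidableEq ι] {F G : (ι → ℝ) → ℝ} {x : ι → ℝ}

theorem fderiv_eq_grad_dotProduct (F : (ι → ℝ) → ℝ) (x v : ι → ℝ) :
    fderiv ℝ F x v = grad F x ⬝ᵥ v := by
  conv_lhs => rw [pi_eq_sum_univ' v]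
  simp [dotProduct, grad, mul_comm]

theorem grad_eq_of_hasFDerivAt {F' : (ι → ℝ) →L[ℝ] ℝ} (h : HasFDerivAt F F' x) :
    grad F x = fun i => F' (Pi.single i 1) := by
  ext i
  rw [grad, h.fderiv]

theorem hasDerivAt_comp_add_smul (F : (ι → ℝ) → ℝ) (x v : ι → ℝ) (t : ℝ)
    (hF : DifferentiableAt ℝ F (x + t • v)) :
    HasDerivAt (fun s : ℝ => F (x + s • v)) (grad F (x + t • v) ⬝ᵥ v) t := by
  rw [← fderiv_eq_grad_dotProduct]
  refine hF.hasFDerivAt.comp_hasDerivAt t ?_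
  simpa using ((hasDerivAt_id t).smul_const v).const_add x

theorem grad_add (hF : DifferentiableAt ℝ F x) (hG : DifferentiableAt ℝ G x) :
    grad (fun y => F y + G y) x = grad F x + grad G x :=
  grad_eq_of_hasFDerivAt (hF.hasFDerivAt.add hG.hasFDerivAt)

theorem grad_sub (hF : DifferentiableAt ℝ F x) (hG : DifferentiableAt ℝ G x) :
    grad (fun y => F y - G y) x = grad F x - grad G x :=
  grad_eq_of_hasFDerivAt (hF.hasFDerivAt.sub hG.hasFDerivAt)

theorem grad_neg (F : (ι → ℝ) → ℝ) (x : ι → ℝ) : grad (-F) x = -grad F x := by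
  ext i
  simp [grad, fderiv_neg]

theorem grad_apply_eq_zero_of_forall_add_smul_single {i : ι}
    (h : ∀ y (t : ℝ), F (y + t • Pi.single i 1) = F y) : grad F x i = 0 := by
  by_cases hF : DifferentiableAt ℝ F x
  · refine (hF.hasFDerivAt.hasLineDerivAt (Pi.single i 1)).unique ?_
    simpa only [HasLineDerivAt, h] using hasDerivAt_const (0 : ℝ) (F x)
  · rw [grad, fderiv_zero_of_not_differentiableAt hF, _root_.zero_apply]

section Reindex

variable {F : (κ → ℝ) → ℝ} {e : κ → ι}

theorem grad_comp_reindex_apply [Fintype κ] [DecidableEq κ] (he : Function.Injective e)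
    (hF : DifferentiableAt ℝ F (x ∘ e)) (k : κ) :
    grad (fun y => F (y ∘ e)) x (e k) = grad F (x ∘ e) k := by
  let reindex : (ι → ℝ) →L[ℝ] κ → ℝ := .pi fun k => .proj (e k)
  have hcomp : HasFDerivAt (fun y => F (y ∘ e)) ((fderiv ℝ F (x ∘ e)).comp reindex) x :=
    hF.hasFDerivAt.comp (g := F) (f := reindex) x reindex.hasFDerivAt
  rw [grad_eq_of_hasFDerivAt hcomp]
  simp only [ContinuousLinearMap.comp_apply, grad]
  congr 1
  ext j
  simp [reindex, Pi.single_apply, he.eq_iff]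

theorem grad_comp_reindex_apply_eq_zero {i : ι} (hi : i ∉ range e) :
    grad (fun y => F (y ∘ e)) x i = 0 := by
  refine grad_apply_eq_zero_of_forall_add_smul_single fun y t => congrArg F ?_
  ext k
  simp [show e k ≠ i from fun h => hi ⟨k, h⟩]

end Reindex

theorem grad_half_quadratic {A : Matrix ι ι ℝ} (hA : Aᵀ = A) (x : ι → ℝ) :
    grad (fun y => 1 / 2 * (y ⬝ᵥ (A *ᵥ y))) x = A *ᵥ x := by
  ext i
  have hd : DifferentiableAt ℝ (fun y : ι → ℝ => 1 / 2 * (y ⬝ᵥ (A *ᵥ y))) x := by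
    simp only [dotProduct, mulVec]; fun_prop
  refine (hd.hasFDerivAt.hasLineDerivAt (Pi.single i 1)).unique ?_
  have hcross : x ⬝ᵥ (A *ᵥ Pi.single i 1) = (A *ᵥ x) i := by
    rw [← hA, dotProduct_transpose_mulVec, single_one_dotProduct, hA]
  have hexpand : ∀ t : ℝ, 1 / 2 * ((x + t • Pi.single i 1) ⬝ᵥ (A *ᵥ (x + t • Pi.single i 1)))
      = 1 / 2 * (x ⬝ᵥ (A *ᵥ x)) + t * (A *ᵥ x) i + t ^ 2 * (1 / 2 * (A *ᵥ Pi.single i 1) i) := by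
    intro t
    simp only [mulVec_add, mulVec_smul, add_dotProduct, dotProduct_add, smul_dotProduct,
      dotProduct_smul, hcross, smul_eq_mul, single_one_dotProduct]
    ring
  simp only [HasLineDerivAt, hexpand]
  have h := (((hasDerivAt_id (0 : ℝ)).mul_const ((A *ᵥ x) i)).const_add
    (1 / 2 * (x ⬝ᵥ (A *ᵥ x)))).add
    ((hasDerivAt_pow 2 (0 : ℝ)).mul_const (1 / 2 * (A *ᵥ Pi.single i 1) i))
  exact h.congr_deriv (by simp)

theorem differentiableAt_shifted (hF : DifferentiableAt ℝ F x) (xbar : ι → ℝ) :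
    DifferentiableAt ℝ (shifted F xbar) x := by
  unfold shifted dotProduct
  fun_prop

theorem contDiff_shifted {n : WithTop ℕ∞} (hF : ContDiff ℝ n F) (xbar : ι → ℝ) :
    ContDiff ℝ n (shifted F xbar) := by
  unfold shifted dotProduct
  fun_prop

theorem grad_shifted (hF : DifferentiableAt ℝ F x) (xbar : ι → ℝ) :
    grad (shifted F xbar) x = grad F x - grad F xbar := by
  have hlin : HasFDerivAt (fun y : ι → ℝ => (y - xbar) ⬝ᵥ grad F xbar) (fderiv ℝ F xbar) x := by
    simp only [dotProduct_comm _ (grad F xbar), ← fderiv_eq_grad_dotProduct]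
    exact (fderiv ℝ F xbar).hasFDerivAt.comp x ((hasFDerivAt_id x).sub_const xbar)
  exact grad_eq_of_hasFDerivAt ((hF.hasFDerivAt.sub hlin).sub_const (F xbar))

theorem contDiffAt_grad {n m : WithTop ℕ∞} (h : ContDiffAt ℝ n F x) (hmn : m + 1 ≤ n) :
    ContDiffAt ℝ m (grad F) x :=
  contDiffAt_pi.2 fun _ => (h.fderiv_right hmn).clm_apply contDiffAt_const

theorem fderiv_grad_dotProduct (h : DifferentiableAt ℝ (grad F) x) (v w : ι → ℝ) :
    fderiv ℝ (grad F) x v ⬝ᵥ w = v ⬝ᵥ (hess F x *ᵥ w) := by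
  have hv : fderiv ℝ (grad F) x v = v ᵥ* hess F x := by
    ext j
    have hj := (hasFDerivAt_pi'.1 h.hasFDerivAt j).fderiv
    calc fderiv ℝ (grad F) x v j = fderiv ℝ (fun y => grad F y j) x v := by rw [hj]; rfl
      _ = v ⬝ᵥ grad (fun y => grad F y j) x := by rw [fderiv_eq_grad_dotProduct, dotProduct_comm]
  rw [hv, dotProduct_mulVec]

theorem grad_sub_dotProduct_pos_of_strictConvexOn (hF : StrictConvexOn ℝ univ F)
    (hd : Differentiable ℝ F) {y : ι → ℝ} (hne : x ≠ y) :
    0 < (grad F x - grad F y) ⬝ᵥ (x - y) := by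
  have hder := fun t => hasDerivAt_comp_add_smul F y (x - y) t (hd _)
  have hmono := (strictConvexOn_comp_add_smul hF y (sub_ne_zero.2 hne)).strictMonoOn_deriv
    fun t _ => (hder t).differentiableAt
  have h01 := hmono (mem_univ 0) (mem_univ 1) zero_lt_one
  rw [(hder 0).deriv, (hder 1).deriv, zero_smul, add_zero, one_smul, add_sub_cancel] at h01
  rwa [sub_dotProduct, sub_pos]

theorem grad_sub_dotProduct_nonneg_of_strictConvexOn (hF : StrictConvexOn ℝ univ F)
    (hd : Differentiable ℝ F) (x y : ι → ℝ) : 0 ≤ (grad F x - grad F y) ⬝ᵥ (x - y) := by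
  rcases eq_or_ne x y with rfl | hne
  · simp
  · exact (grad_sub_dotProduct_pos_of_strictConvexOn hF hd hne).le

theorem eq_of_grad_sub_dotProduct_eq_zero (hF : StrictConvexOn ℝ univ F)
    (hd : Differentiable ℝ F) {x y : ι → ℝ} (h : (grad F x - grad F y) ⬝ᵥ (x - y) = 0) : x = y :=
  by_contra fun hne => (grad_sub_dotProduct_pos_of_strictConvexOn hF hd hne).ne' h

end Grad

/-! ### Strong monotonicity -/

section StrongMono

variable {ι : Type} [Fintype ι]

theorem dotProduct_mulVec_nonneg_of_posDef {A : Matrix ι ι ℝ} (hA : A.PosDef) (v : ι → ℝ) :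
    0 ≤ v ⬝ᵥ (A *ᵥ v) := by
  simpa using hA.posSemidef.dotProduct_mulVec_nonneg v

theorem eq_zero_of_dotProduct_mulVec_eq_zero {A : Matrix ι ι ℝ} (hA : A.PosDef) {v : ι → ℝ}
    (h : v ⬝ᵥ (A *ᵥ v) = 0) : v = 0 :=
  by_contra fun hv => (hA.dotProduct_mulVec_pos hv).ne' (by simpa using h)

theorem abs_dotProduct_le (v w : ι → ℝ) : |v ⬝ᵥ w| ≤ Fintype.card ι * ‖v‖ * ‖w‖ := by
  calc |v ⬝ᵥ w| ≤ ∑ i, |v i * w i| := Finset.abs_sum_le_sum_abs _ _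
    _ ≤ ∑ _i : ι, ‖v‖ * ‖w‖ := by
        refine Finset.sum_le_sum fun i _ => ?_
        rw [abs_mul]
        exact mul_le_mul (norm_le_pi_norm v i) (norm_le_pi_norm w i) (abs_nonneg _) (norm_nonneg _)
    _ = Fintype.card ι * ‖v‖ * ‖w‖ := by simp [mul_assoc]

theorem exists_mul_norm_sq_le_of_posDef {A : Matrix ι ι ℝ} (hA : A.PosDef) :
    ∃ c > 0, ∀ v, c * ‖v‖ ^ 2 ≤ v ⬝ᵥ (A *ᵥ v) := by
  rcases isEmpty_or_nonempty ι with hι | hι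
  · exact ⟨1, one_pos, fun v => by simp [Subsingleton.elim v 0]⟩
  have hcont : Continuous fun v : ι → ℝ => v ⬝ᵥ (A *ᵥ v) := by fun_prop
  obtain ⟨u, hu, hmin⟩ := (isCompact_sphere (0 : ι → ℝ) 1).exists_isMinOn
    (NormedSpace.sphere_nonempty.2 zero_le_one) hcont.continuousOn
  have hu0 : u ≠ 0 := ne_zero_of_mem_unit_sphere ⟨u, hu⟩
  refine ⟨u ⬝ᵥ (A *ᵥ u), by simpa using hA.dotProduct_mulVec_pos hu0, fun v => ?_⟩
  rcases eq_or_ne v 0 with rfl | hv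
  · simp
  have hn : 0 < ‖v‖ := norm_pos_iff.2 hv
  have hsphere : ‖v‖⁻¹ • v ∈ Metric.sphere (0 : ι → ℝ) 1 := by simp [norm_smul, hn.ne']
  have hle : u ⬝ᵥ (A *ᵥ u) ≤ ‖v‖⁻¹ * (‖v‖⁻¹ * (v ⬝ᵥ (A *ᵥ v))) := by
    simpa only [mem_ofPred_eq, smul_dotProduct, mulVec_smul, dotProduct_smul, smul_eq_mul]
      using hmin hsphere
  calc u ⬝ᵥ (A *ᵥ u) * ‖v‖ ^ 2 ≤ ‖v‖⁻¹ * (‖v‖⁻¹ * (v ⬝ᵥ (A *ᵥ v))) * ‖v‖ ^ 2 := by gcongr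
    _ = v ⬝ᵥ (A *ᵥ v) := by field_simp

/-- Strong monotonicity with modulus `c` of a vector field `G` on a set `s`. The duality pairing is
the dot product, while the norm is the sup norm. -/
def StrongMonoOn (c : ℝ) (s : Set (ι → ℝ)) (G : (ι → ℝ) → ι → ℝ) : Prop :=
  ∀ y ∈ s, ∀ z ∈ s, c * ‖y - z‖ ^ 2 ≤ (G y - G z) ⬝ᵥ (y - z)

theorem StrongMonoOn.mono {c : ℝ} {s t : Set (ι → ℝ)} {G : (ι → ℝ) → ι → ℝ}
    (h : StrongMonoOn c t G) (hst : s ⊆ t) : StrongMonoOn c s G :=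
  fun y hy z hz => h y (hst hy) z (hst hz)

theorem exists_strongMonoOn_of_hasStrictFDerivAt {G : (ι → ℝ) → ι → ℝ}
    {G' : (ι → ℝ) →L[ℝ] ι → ℝ} {x : ι → ℝ} {c c' : ℝ} (hG : HasStrictFDerivAt G G' x)
    (hc : ∀ v, c * ‖v‖ ^ 2 ≤ G' v ⬝ᵥ v) (hcc' : c' < c) : ∃ s ∈ 𝓝 x, StrongMonoOn c' s G := by
  set n : ℝ := (Fintype.card ι : ℝ)
  have hn : 0 ≤ n := Nat.cast_nonneg _
  have hε : 0 < (c - c') / (n + 1) := div_pos (sub_pos.2 hcc') (by positivity)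
  have hev := hG.isLittleO.def hε
  rw [nhds_prod_eq] at hev
  obtain ⟨s, hs, hs'⟩ := Filter.eventually_prod_self_iff'.1 hev
  refine ⟨s, hs, fun y hy z hz => ?_⟩
  set R := G y - G z - G' (y - z) with hR
  have hsplit : (G y - G z) ⬝ᵥ (y - z) = G' (y - z) ⬝ᵥ (y - z) + R ⬝ᵥ (y - z) := by
    rw [← add_dotProduct, hR, add_sub_cancel]
  have hrem : |R ⬝ᵥ (y - z)| ≤ (c - c') * ‖y - z‖ ^ 2 := by
    calc |R ⬝ᵥ (y - z)| ≤ n * ‖R‖ * ‖y - z‖ := abs_dotProduct_le _ _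
      _ ≤ (n + 1) * ((c - c') / (n + 1) * ‖y - z‖) * ‖y - z‖ := by
          gcongr
          · linarith
          · exact hs' y hy z hz
      _ = (c - c') * ‖y - z‖ ^ 2 := by field_simp
  linarith [hc (y - z), (abs_le.1 hrem).1]

variable [DecidableEq ι] {F : (ι → ℝ) → ℝ} {x : ι → ℝ}

theorem exists_strongMonoOn_grad_of_posDef_hess (hF : ContDiffAt ℝ 2 F x)
    (hpos : (hess F x).PosDef) : ∃ c > 0, ∃ s ∈ 𝓝 x, StrongMonoOn c s (grad F) := by
  obtain ⟨c, hc, hcv⟩ := exists_mul_norm_sq_le_of_posDef hpos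
  have hG : ContDiffAt ℝ 1 (grad F) x := contDiffAt_grad hF (by norm_num)
  have hd := hG.differentiableAt one_ne_zero
  exact ⟨c / 2, half_pos hc, exists_strongMonoOn_of_hasStrictFDerivAt
    (hG.hasStrictFDerivAt one_ne_zero)
    (fun v => by rw [fderiv_grad_dotProduct hd]; exact hcv v) (half_lt_self hc)⟩

namespace StrongMonoOn

variable {c : ℝ} {s : Set (ι → ℝ)}

theorem mul_le_grad_add_smul_dotProduct (h : StrongMonoOn c s (grad F)) {v : ι → ℝ} {t : ℝ}
    (ht : 0 < t) (hx : x ∈ s) (hxv : x + t • v ∈ s) :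
    c * ‖v‖ ^ 2 * t ≤ (grad F (x + t • v) - grad F x) ⬝ᵥ v := by
  have hle := h _ hxv _ hx
  rw [add_sub_cancel_left, dotProduct_smul, norm_smul, Real.norm_of_nonneg ht.le,
    smul_eq_mul] at hle
  refine le_of_mul_le_mul_left ?_ ht
  linarith

theorem add_le_apply (h : StrongMonoOn c s (grad F)) (hs : Convex ℝ s)
    (hF : ∀ y ∈ s, DifferentiableAt ℝ F y) (hx : x ∈ s) {y : ι → ℝ} (hy : y ∈ s) :
    F x + grad F x ⬝ᵥ (y - x) + c / 2 * ‖y - x‖ ^ 2 ≤ F y := by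
  set v := y - x with hv
  have hmem : ∀ t ∈ Icc (0 : ℝ) 1, x + t • v ∈ s := fun t ht => hs.add_smul_sub_mem hx hy ht
  have hder : ∀ t ∈ Icc (0 : ℝ) 1, HasDerivAt
      (fun t : ℝ => F (x + t • v) - (grad F x ⬝ᵥ v) * t - c / 2 * ‖v‖ ^ 2 * t ^ 2)
      (grad F (x + t • v) ⬝ᵥ v - grad F x ⬝ᵥ v - c * ‖v‖ ^ 2 * t) t := fun t ht => by
    refine (((hasDerivAt_comp_add_smul F x v t (hF _ (hmem t ht))).sub
      ((hasDerivAt_id t).const_mul (grad F x ⬝ᵥ v))).sub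
      ((hasDerivAt_pow 2 t).const_mul (c / 2 * ‖v‖ ^ 2))).congr_deriv ?_
    norm_num
    ring
  have hmono : MonotoneOn
      (fun t : ℝ => F (x + t • v) - (grad F x ⬝ᵥ v) * t - c / 2 * ‖v‖ ^ 2 * t ^ 2) (Icc 0 1) := by
    refine monotoneOn_of_hasDerivWithinAt_nonneg (convex_Icc 0 1)
      (fun t ht => (hder t ht).continuousAt.continuousWithinAt)
      (fun t ht => (hder t (interior_subset ht)).hasDerivWithinAt) fun t ht => ?_
    rw [← sub_dotProduct, sub_nonneg]
    rw [interior_Icc] at ht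
    exact h.mul_le_grad_add_smul_dotProduct ht.1 hx (hmem t (Ioo_subset_Icc_self ht))
  have h01 := hmono (left_mem_Icc.2 zero_le_one) (right_mem_Icc.2 zero_le_one) zero_le_one
  simp only [zero_smul, one_smul, add_zero, hv, add_sub_cancel] at h01
  linarith

end StrongMonoOn

end StrongMono

/-! ### Lipschitz differential equations -/

theorem forall_lt_of_forall_le_imp_lt {g : ℝ → ℝ} {a b ε : ℝ} (hg : ContinuousOn g (Icc a b))
    (ha : g a < ε) (h : ∀ T ∈ Icc a b, (∀ t ∈ Icc a T, g t ≤ ε) → g T < ε) :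
    ∀ t ∈ Icc a b, g t < ε := by
  intro t ht
  by_contra hcon
  have hcomp : IsCompact (Icc a b ∩ g ⁻¹' Ici ε) :=
    isCompact_Icc.of_isClosed_subset (hg.preimage_isClosed_of_isClosed isClosed_Icc isClosed_Ici)
      inter_subset_left
  obtain ⟨T, ⟨hT, hTε⟩, hleast⟩ := hcomp.exists_isLeast ⟨t, ht, not_lt.1 hcon⟩
  have hTa : a ≠ T := by
    rintro rfl
    exact ha.not_ge hTε
  have hbefore : ∀ s ∈ Ico a T, g s ≤ ε := fun s hs => le_of_not_ge fun hs' =>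
    hs.2.not_ge (hleast ⟨⟨hs.1, hs.2.le.trans hT.2⟩, hs'⟩)
  refine (h T hT ?_).not_ge hTε
  rw [← closure_Ico hTa]
  refine fun s hs => le_on_closure hbefore ?_ continuousOn_const hs
  rw [closure_Ico hTa]
  exact hg.mono (Icc_subset_Icc_right hT.2)

theorem exists_lipschitzWith_retraction_closedBall {ι : Type*} [Fintype ι] (c : ι → ℝ) {ρ : ℝ}
    (hρ : 0 ≤ ρ) : ∃ p : (ι → ℝ) → ι → ℝ, LipschitzWith 1 p ∧
      (∀ d, p d ∈ Metric.closedBall c ρ) ∧ EqOn p id (Metric.closedBall c ρ) := by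
  have hle : ∀ i, c i - ρ ≤ c i + ρ := fun i => by linarith
  simp_rw [closedBall_pi c hρ, Real.closedBall_eq_Icc]
  refine ⟨fun d i => projIcc _ _ (hle i) (d i),
    LipschitzWith.of_dist_le_mul fun d d' => (dist_pi_le_iff (by positivity)).2 fun i => ?_,
    fun d i _ => (projIcc _ _ (hle i) (d i)).2,
    fun d hd => funext fun i => congrArg Subtype.val (projIcc_of_mem (hle i) (hd i (mem_univ i)))⟩
  calc dist (projIcc _ _ (hle i) (d i)) (projIcc _ _ (hle i) (d' i))
      ≤ (1 : NNReal) * dist (d i) (d' i) := (LipschitzWith.projIcc (hle i)).dist_le_mul _ _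
    _ ≤ (1 : NNReal) * dist d d' := by gcongr; exact dist_le_pi_dist d d' i

section ODE

variable {E : Type*} [NormedAddCommGroup E] [NormedSpace ℝ E] {F : E → E} {K L : NNReal}

theorem eqOn_Ioo_of_hasDerivAt_of_lipschitzWith (hF : LipschitzWith K F) {y z : ℝ → E} {a b t₀ : ℝ}
    (ht₀ : t₀ ∈ Ioo a b) (hy : ∀ t ∈ Ioo a b, HasDerivAt y (F (y t)) t)
    (hz : ∀ t ∈ Ioo a b, HasDerivAt z (F (z t)) t) (h0 : y t₀ = z t₀) : EqOn y z (Ioo a b) :=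
  ODE_solution_unique_of_mem_Ioo (v := fun _ => F) (s := fun _ => univ)
    (fun _ _ => hF.lipschitzOnWith) ht₀ (fun t ht => ⟨hy t ht, trivial⟩)
    (fun t ht => ⟨hz t ht, trivial⟩) h0

variable [CompleteSpace E]

theorem exists_forall_Ioo_hasDerivAt_of_lipschitzWith (hF : LipschitzWith K F)
    (hL : ∀ x, ‖F x‖ ≤ L) (x₀ : E) (T : NNReal) :
    ∃ y : ℝ → E, y 0 = x₀ ∧ ∀ t ∈ Ioo (-(T : ℝ)) T, HasDerivAt y (F (y t)) t := by
  have hPL : IsPicardLindelof (fun _ => F) (⟨0, by simp⟩ : Icc (-(T : ℝ)) T) x₀ (L * T) 0 L K :=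
    IsPicardLindelof.of_time_independent (fun x _ => hL x) hF.lipschitzOnWith (by simp)
  obtain ⟨y, hy0, hy⟩ := hPL.exists_eq_forall_mem_Icc_hasDerivWithinAt₀
  exact ⟨y, hy0, fun t ht =>
    (hy t (Ioo_subset_Icc_self ht)).hasDerivAt (Icc_mem_nhds ht.1 ht.2)⟩

theorem exists_forall_hasDerivAt_of_lipschitzWith (hF : LipschitzWith K F)
    (hL : ∀ x, ‖F x‖ ≤ L) (x₀ : E) : ∃ y : ℝ → E, y 0 = x₀ ∧ ∀ t, HasDerivAt y (F (y t)) t := by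
  choose Y hY0 hY using fun n : ℕ =>
    exists_forall_Ioo_hasDerivAt_of_lipschitzWith hF hL x₀ (n + 1 : NNReal)
  simp only [NNReal.coe_add, NNReal.coe_natCast, NNReal.coe_one] at hY
  have agree : ∀ m n : ℕ, m ≤ n → EqOn (Y m) (Y n) (Ioo (-((m : ℝ) + 1)) (m + 1)) := by
    intro m n hmn
    have hsub : Ioo (-((m : ℝ) + 1)) (m + 1) ⊆ Ioo (-((n : ℝ) + 1)) (n + 1) := by gcongr
    exact eqOn_Ioo_of_hasDerivAt_of_lipschitzWith hF (t₀ := 0) (by constructor <;> linarith)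
      (hY m) (fun t ht => hY n t (hsub ht)) (by rw [hY0, hY0])
  have hceil : ∀ s : ℝ, s ∈ Ioo (-((⌈|s|⌉₊ : ℝ) + 1)) (⌈|s|⌉₊ + 1) := fun s =>
    abs_lt.1 ((Nat.le_ceil |s|).trans_lt (lt_add_one _))
  refine ⟨fun t => Y ⌈|t|⌉₊ t, hY0 _, fun t => ?_⟩
  refine (hY ⌈|t|⌉₊ t (hceil t)).congr_of_eventuallyEq ?_
  filter_upwards [Ioo_mem_nhds (hceil t).1 (hceil t).2] with s hs
  rcases le_total ⌈|s|⌉₊ ⌈|t|⌉₊ with h | h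
  · exact agree _ _ h (hceil s)
  · exact (agree _ _ h hs).symm

end ODE

/-! ### Lyapunov functions of differential-algebraic equations -/

namespace DAE

variable {ι κ : Type} {S : DAE ι κ}

/-- The differential variables `x` of a state `(x, y)`. -/
def diffPart (x : ι ⊕ κ → ℝ) : ι → ℝ := fun i => x (.inl i)

/-- The algebraic variables `y` of a state `(x, y)`. -/
def algPart (x : ι ⊕ κ → ℝ) : κ → ℝ := fun k => x (.inr k)

namespace IsSolutionOn

variable {J J' : Set ℝ} {x : ℝ → ι ⊕ κ → ℝ}

theorem mono (hx : S.IsSolutionOn J x) (h : J' ⊆ J) : S.IsSolutionOn J' x where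
  continuousOn := hx.continuousOn.mono h
  mem_dom t ht := hx.mem_dom t (h ht)
  differential t ht i := (hx.differential t (h ht) i).mono h
  algebraic t ht := hx.algebraic t (h ht)

theorem mem_consistent (hx : S.IsSolutionOn J x) {t : ℝ} (ht : t ∈ J) : x t ∈ S.consistent :=
  ⟨hx.mem_dom t ht, hx.algebraic t ht⟩

theorem hasDerivWithinAt [Finite ι] (hx : S.IsSolutionOn J x) {t : ℝ} (ht : t ∈ J) :
    HasDerivWithinAt (fun s => diffPart (x s)) (S.f (x t)) J t :=
  have := Fintype.ofFinite ι
  hasDerivWithinAt_pi.2 fun i => hx.differential t ht i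

theorem comp_add_const (hx : S.IsSolutionOn (Ici 0) x) {a : ℝ} (ha : 0 ≤ a) :
    S.IsSolutionOn (Ici 0) fun t => x (t + a) := by
  have hmaps : MapsTo (· + a) (Ici 0) (Ici 0) := fun t ht => add_nonneg ht ha
  refine ⟨hx.continuousOn.comp (by fun_prop) hmaps, fun t ht => hx.mem_dom _ (hmaps ht),
    fun t ht i => ?_, fun t ht => hx.algebraic _ (hmaps ht)⟩
  have hshift : HasDerivWithinAt (· + a) 1 (Ici 0) t :=
    ((hasDerivAt_id t).add_const a).hasDerivWithinAt
  simpa [Function.comp_def] using (hx.differential _ (hmaps ht) i).comp t hshift hmaps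

theorem f_apply_eq_zero_of_const (hx : S.IsSolutionOn J x) {t : ℝ} (ht : t ∈ J)
    (huniq : UniqueDiffWithinAt ℝ J t) {i : ι} {a : ℝ} (hconst : ∀ s ∈ J, x s (.inl i) = a) :
    S.f (x t) i = 0 :=
  huniq.eq_deriv J (hx.differential t ht i) ((hasDerivWithinAt_const t J a).congr_of_mem hconst ht)

end IsSolutionOn

theorem continuous_sumElim :
    Continuous fun p : (ι → ℝ) × (κ → ℝ) => (Sum.elim p.1 p.2 : ι ⊕ κ → ℝ) :=
  Homeomorph.sumArrowHomeomorphProdArrow.symm.continuous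

variable [Fintype ι] [Fintype κ]

theorem dist_diffPart_le (x y : ι ⊕ κ → ℝ) : dist (diffPart x) (diffPart y) ≤ dist x y :=
  (dist_pi_le_iff dist_nonneg).2 fun i => dist_le_pi_dist x y (.inl i)

theorem dist_algPart_le (x y : ι ⊕ κ → ℝ) : dist (algPart x) (algPart y) ≤ dist x y :=
  (dist_pi_le_iff dist_nonneg).2 fun k => dist_le_pi_dist x y (.inr k)

theorem sumElim_mem_closedBall {xbar : ι ⊕ κ → ℝ} {r : ℝ} {d : ι → ℝ} {a : κ → ℝ}
    (hd : d ∈ Metric.closedBall (diffPart xbar) r) (ha : a ∈ Metric.closedBall (algPart xbar) r) :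
    Sum.elim d a ∈ Metric.closedBall xbar r := by
  have hr : 0 ≤ r := dist_nonneg.trans hd
  rw [Metric.mem_closedBall, dist_pi_le_iff hr, Sum.forall]
  exact ⟨(dist_pi_le_iff hr).1 hd, (dist_pi_le_iff hr).1 ha⟩

theorem dotProduct_eq_diffPart {v : ι ⊕ κ → ℝ} (hv : ∀ k, v (.inr k) = 0) (w : ι ⊕ κ → ℝ) :
    v ⬝ᵥ w = diffPart v ⬝ᵥ diffPart w := by
  simp [dotProduct, Fintype.sum_sum_type, hv, diffPart]

/-- A reduction of `S` near `xbar` to an ordinary differential equation with right-hand side `F`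
for the differential variables; `s` recovers the state from them. To have global solutions, `F` is
taken bounded and globally Lipschitz, and it has its meaning only on the ball of radius `ρ`. -/
structure ReductionOn (S : DAE ι κ) (xbar : ι ⊕ κ → ℝ) (r ρ : ℝ) (C : NNReal)
    (F : (ι → ℝ) → ι → ℝ) (s : (ι → ℝ) → ι ⊕ κ → ℝ) : Prop where
  ρ_pos : 0 < ρ
  ρ_le : ρ ≤ r
  lipschitz_F : ∃ K : NNReal, LipschitzWith K F
  bounded_F : ∃ L : NNReal, ∀ d, ‖F d‖ ≤ L
  lipschitz_s : LipschitzOnWith C s (Metric.closedBall (diffPart xbar) ρ)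
  s_mem : ∀ d ∈ Metric.closedBall (diffPart xbar) ρ, s d ∈ Metric.closedBall xbar r
  algebraic_s : ∀ d ∈ Metric.closedBall (diffPart xbar) ρ, S.g (s d) = 0
  diffPart_s : ∀ d ∈ Metric.closedBall (diffPart xbar) ρ, diffPart (s d) = d
  s_diffPart : ∀ x ∈ Metric.closedBall xbar ρ, S.g x = 0 → s (diffPart x) = x
  F_eq : ∀ d ∈ Metric.closedBall (diffPart xbar) ρ, F d = S.f (s d)

namespace ReductionOn

variable {xbar : ι ⊕ κ → ℝ} {r ρ : ℝ} {C : NNReal} {F : (ι → ℝ) → ι → ℝ}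
  {s : (ι → ℝ) → ι ⊕ κ → ℝ}

theorem hasDerivWithinAt (hR : S.ReductionOn xbar r ρ C F s) {J : Set ℝ} {x : ℝ → ι ⊕ κ → ℝ}
    (hx : S.IsSolutionOn J x) {t : ℝ} (ht : t ∈ J) (hball : x t ∈ Metric.closedBall xbar ρ) :
    HasDerivWithinAt (fun t => diffPart (x t)) (F (diffPart (x t))) J t := by
  rw [hR.F_eq _ ((dist_diffPart_le _ _).trans hball), hR.s_diffPart _ hball (hx.algebraic t ht)]
  exact hx.hasDerivWithinAt ht

theorem isSolutionOn (hR : S.ReductionOn xbar r ρ C F s)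
    (hdom : Metric.closedBall xbar r ⊆ S.dom) {J : Set ℝ} {y : ℝ → ι → ℝ}
    (hy : ∀ t, HasDerivAt y (F (y t)) t)
    (hball : ∀ t ∈ J, y t ∈ Metric.closedBall (diffPart xbar) ρ) :
    S.IsSolutionOn J fun t => s (y t) where
  continuousOn := hR.lipschitz_s.continuousOn.comp
    (fun t _ => (hy t).continuousAt.continuousWithinAt) hball
  mem_dom t ht := hdom (hR.s_mem _ (hball t ht))
  differential t ht i := by
    rw [← hR.F_eq _ (hball t ht)]
    exact (hasDerivAt_pi.1 (hy t) i).hasDerivWithinAt.congr_of_mem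
      (fun u hu => congrFun (hR.diffPart_s _ (hball u hu)) i) ht
  algebraic t ht := hR.algebraic_s _ (hball t ht)

theorem exists_dist_le_mul_exp (hR : S.ReductionOn xbar r ρ C F s) :
    ∃ L : ℝ, ∀ T ≥ 0, ∀ x y : ℝ → ι ⊕ κ → ℝ,
      S.IsSolutionOn (Icc 0 T) x → (∀ t ∈ Icc 0 T, x t ∈ Metric.closedBall xbar ρ) →
      S.IsSolutionOn (Icc 0 T) y → (∀ t ∈ Icc 0 T, y t ∈ Metric.closedBall xbar ρ) →
      dist (x T) (y T) ≤ C * (dist (x 0) (y 0) * Real.exp (L * T)) := by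
  obtain ⟨L, hL⟩ := hR.lipschitz_F
  refine ⟨L, fun T hT x y hx hxb hy hyb => ?_⟩
  have hTT : T ∈ Icc 0 T := right_mem_Icc.2 hT
  have hcont : ∀ z, S.IsSolutionOn (Icc 0 T) z → ContinuousOn (fun t => diffPart (z t)) (Icc 0 T) :=
    fun z hz t ht => (hz.hasDerivWithinAt ht).continuousWithinAt
  have hder : ∀ z, S.IsSolutionOn (Icc 0 T) z → (∀ t ∈ Icc 0 T, z t ∈ Metric.closedBall xbar ρ) →
      ∀ t ∈ Ico 0 T, HasDerivWithinAt (fun t => diffPart (z t)) (F (diffPart (z t))) (Ici t) t :=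
    fun z hz hzb t ht => by
      have htT := Ico_subset_Icc_self ht
      exact (hR.hasDerivWithinAt hz htT (hzb t htT)).mono_of_mem_nhdsWithin
        (mem_of_superset (Icc_mem_nhdsGE ht.2) (Icc_subset_Icc_left ht.1))
  have hgron := dist_le_of_trajectories_ODE (v := fun _ => F) (fun _ => hL) (hcont x hx)
    (hder x hx hxb) (hcont y hy) (hder y hy hyb) (dist_diffPart_le (x 0) (y 0)) T hTT
  have hs := hR.lipschitz_s.dist_le_mul
    (diffPart (x T)) ((dist_diffPart_le _ _).trans (hxb T hTT))
    (diffPart (y T)) ((dist_diffPart_le _ _).trans (hyb T hTT))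
  rw [hR.s_diffPart _ (hxb T hTT) (hx.algebraic T hTT),
    hR.s_diffPart _ (hyb T hTT) (hy.algebraic T hTT)] at hs
  rw [sub_zero] at hgron
  exact hs.trans (by gcongr)

theorem tendsto_add (hR : S.ReductionOn xbar r ρ C F s) {x y : ℝ → ι ⊕ κ → ℝ}
    (hx : S.IsSolutionOn (Ici 0) x) (hxb : ∀ t ∈ Ici 0, x t ∈ Metric.closedBall xbar ρ)
    (hy : S.IsSolutionOn (Ici 0) y) (hyb : ∀ t ∈ Ici 0, y t ∈ Metric.closedBall xbar ρ)
    {u : ℕ → ℝ} (hu : ∀ n, 0 ≤ u n) (hlim : Tendsto (fun n => x (u n)) atTop (𝓝 (y 0)))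
    {t : ℝ} (ht : 0 ≤ t) : Tendsto (fun n => x (t + u n)) atTop (𝓝 (y t)) := by
  obtain ⟨L, hL⟩ := hR.exists_dist_le_mul_exp
  have hsub : Icc 0 t ⊆ Ici 0 := Icc_subset_Ici_self
  have hbound : ∀ n, dist (x (t + u n)) (y t) ≤ C * (dist (x (u n)) (y 0) * Real.exp (L * t)) := by
    intro n
    simpa only [zero_add] using hL t ht (fun v => x (v + u n)) y
      ((hx.comp_add_const (hu n)).mono hsub) (fun v hv => hxb _ (add_nonneg hv.1 (hu n)))
      (hy.mono hsub) (fun v hv => hyb v hv.1)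
  rw [tendsto_iff_dist_tendsto_zero] at hlim ⊢
  refine squeeze_zero (fun _ => dist_nonneg) hbound ?_
  simpa using (hlim.mul_const (Real.exp (L * t))).const_mul (C : ℝ)

end ReductionOn

variable [DecidableEq ι] [DecidableEq κ]

theorem grad_inr_eq_zero_of_isLocalMin {H : (ι ⊕ κ → ℝ) → ℝ} {d : ι → ℝ} {a : κ → ℝ}
    (hH : DifferentiableAt ℝ H (Sum.elim d a)) (hmin : IsLocalMin (fun b => H (Sum.elim d b)) a)
    (k : κ) : grad H (Sum.elim d a) (.inr k) = 0 := by
  have hline : ∀ t : ℝ, Sum.elim d a + t • Pi.single (.inr k) 1 =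
      (Sum.elim d (a + t • Pi.single k 1) : ι ⊕ κ → ℝ) := by
    intro t
    ext (i | j) <;> simp [Pi.single_apply]
  have hmin₀ : IsLocalMin (fun t : ℝ => H (Sum.elim d (a + t • Pi.single k 1))) 0 :=
    IsLocalMin.comp_continuous (f := fun b => H (Sum.elim d b))
      (g := fun t : ℝ => a + t • Pi.single k 1) (by simpa using hmin)
      (by fun_prop : Continuous fun t : ℝ => a + t • (Pi.single k 1 : κ → ℝ)).continuousAt
  have hderiv := hH.hasFDerivAt.hasLineDerivAt (Pi.single (.inr k) 1)
  simp only [HasLineDerivAt, hline] at hderiv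
  exact hmin₀.hasDerivAt_eq_zero hderiv

/-- `H` is a Lyapunov function for the system `S` on the closed ball of radius `r` around `xbar`:
it is strongly convex there, the algebraic equations are the vanishing of its partial derivatives
in the algebraic variables, it is non-increasing along solutions, and it is stationary at every
state from which it is conserved. -/
structure LyapunovOn (S : DAE ι κ) (H : (ι ⊕ κ → ℝ) → ℝ) (xbar : ι ⊕ κ → ℝ) (r c : ℝ)
    (K : NNReal) : Prop where
  r_pos : 0 < r
  c_pos : 0 < c
  subset_dom : Metric.closedBall xbar r ⊆ S.dom
  differentiableAt : ∀ x ∈ Metric.closedBall xbar r, DifferentiableAt ℝ H x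
  lipschitz_grad : LipschitzOnWith K (grad H) (Metric.closedBall xbar r)
  lipschitz_f : LipschitzOnWith K S.f (Metric.closedBall xbar r)
  strongMono : StrongMonoOn c (Metric.closedBall xbar r) (grad H)
  grad_eq_zero : grad H xbar = 0
  algebraic_iff : ∀ x ∈ S.dom, S.g x = 0 ↔ ∀ k, grad H x (.inr k) = 0
  dissipation : ∀ x ∈ S.consistent, diffPart (grad H x) ⬝ᵥ S.f x ≤ 0
  detectable : ∀ x, S.IsSolutionOn (Ici 0) x →
    (∀ t ≥ 0, diffPart (grad H (x t)) ⬝ᵥ S.f (x t) = 0) → grad H (x 0) = 0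

namespace LyapunovOn

variable {H : (ι ⊕ κ → ℝ) → ℝ} {xbar : ι ⊕ κ → ℝ} {r c : ℝ} {K : NNReal}

theorem mem_closedBall_self (h : S.LyapunovOn H xbar r c K) : xbar ∈ Metric.closedBall xbar r :=
  Metric.mem_closedBall_self h.r_pos.le

theorem continuousOn (h : S.LyapunovOn H xbar r c K) : ContinuousOn H (Metric.closedBall xbar r) :=
  fun x hx => (h.differentiableAt x hx).continuousAt.continuousWithinAt

theorem quadratic_le (h : S.LyapunovOn H xbar r c K) {x : ι ⊕ κ → ℝ}
    (hx : x ∈ Metric.closedBall xbar r) : H xbar + c / 2 * dist x xbar ^ 2 ≤ H x := by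
  simpa only [h.grad_eq_zero, zero_dotProduct, add_zero, dist_eq_norm] using
    h.strongMono.add_le_apply (convex_closedBall xbar r) h.differentiableAt h.mem_closedBall_self hx

theorem lt_of_apply_lt (h : S.LyapunovOn H xbar r c K) {x : ι ⊕ κ → ℝ}
    (hx : x ∈ Metric.closedBall xbar r) {ε : ℝ} (hε : 0 ≤ ε)
    (hlt : H x < H xbar + c / 2 * ε ^ 2) : dist x xbar < ε := by
  have hc := h.c_pos
  refine lt_of_pow_lt_pow_left₀ 2 hε (lt_of_mul_lt_mul_left ?_ (half_pos hc).le)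
  linarith [h.quadratic_le hx]

theorem eventually_apply_lt (h : S.LyapunovOn H xbar r c K) {ε : ℝ} (hε : 0 < ε) :
    ∀ᶠ x in 𝓝 xbar, H x < H xbar + c / 2 * ε ^ 2 := by
  have hc := h.c_pos
  exact (h.differentiableAt _ h.mem_closedBall_self).continuousAt.eventually
    (gt_mem_nhds (lt_add_of_pos_right _ (by positivity)))

theorem eq_of_grad_eq_zero (h : S.LyapunovOn H xbar r c K) {x : ι ⊕ κ → ℝ}
    (hx : x ∈ Metric.closedBall xbar r) (hgrad : grad H x = 0) : x = xbar := by
  have hmono := h.strongMono x hx xbar h.mem_closedBall_self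
  rw [hgrad, h.grad_eq_zero, sub_zero, zero_dotProduct] at hmono
  have hnorm : ‖x - xbar‖ ^ 2 ≤ 0 := nonpos_of_mul_nonpos_right hmono h.c_pos
  exact sub_eq_zero.1 (norm_eq_zero.1 (pow_eq_zero_iff two_ne_zero |>.1
    (le_antisymm hnorm (sq_nonneg _))))

theorem exists_dist_le (h : S.LyapunovOn H xbar r c K) :
    ∃ C : NNReal, ∀ x ∈ Metric.closedBall xbar r, ∀ y ∈ Metric.closedBall xbar r,
      S.g x = 0 → S.g y = 0 → dist x y ≤ C * dist (diffPart x) (diffPart y) := by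
  have hc := h.c_pos
  refine ⟨⟨Fintype.card ι * K / c, by positivity⟩, fun x hx y hy gx gy => ?_⟩
  rcases eq_or_ne x y with rfl | hne
  · simp
  have hpos : 0 < dist x y := dist_pos.2 hne
  have hzero : ∀ k, (grad H x - grad H y) (.inr k) = 0 := fun k => by
    rw [Pi.sub_apply, (h.algebraic_iff x (h.subset_dom hx)).1 gx,
      (h.algebraic_iff y (h.subset_dom hy)).1 gy, sub_zero]
  have hgrad : ‖diffPart (grad H x - grad H y)‖ ≤ K * dist x y :=
    calc ‖diffPart (grad H x - grad H y)‖ = dist (diffPart (grad H x)) (diffPart (grad H y)) :=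
          (dist_eq_norm _ _).symm
      _ ≤ dist (grad H x) (grad H y) := dist_diffPart_le _ _
      _ ≤ K * dist x y := h.lipschitz_grad.dist_le_mul x hx y hy
  have hmul : dist x y * (c * dist x y) ≤
      dist x y * (Fintype.card ι * K * dist (diffPart x) (diffPart y)) :=
    calc dist x y * (c * dist x y) = c * ‖x - y‖ ^ 2 := by rw [dist_eq_norm]; ring
      _ ≤ diffPart (grad H x - grad H y) ⬝ᵥ diffPart (x - y) := by
          rw [← dotProduct_eq_diffPart hzero]
          exact h.strongMono x hx y hy
      _ ≤ Fintype.card ι * ‖diffPart (grad H x - grad H y)‖ * ‖diffPart (x - y)‖ :=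
          (le_abs_self _).trans (abs_dotProduct_le _ _)
      _ ≤ Fintype.card ι * (K * dist x y) * ‖diffPart (x - y)‖ := by gcongr
      _ = dist x y * (Fintype.card ι * K * dist (diffPart x) (diffPart y)) := by
          rw [dist_eq_norm (diffPart x)]; change _ * ‖diffPart x - diffPart y‖ = _; ring
  change dist x y ≤ Fintype.card ι * K / c * dist (diffPart x) (diffPart y)
  rw [div_mul_eq_mul_div, le_div_iff₀ hc, mul_comm]
  exact le_of_mul_le_mul_left hmul hpos

theorem isCompact_consistent_inter_closedBall (h : S.LyapunovOn H xbar r c K) {η : ℝ}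
    (hη : η ≤ r) : IsCompact (S.consistent ∩ Metric.closedBall xbar η) := by
  have hsub : Metric.closedBall xbar η ⊆ Metric.closedBall xbar r :=
    Metric.closedBall_subset_closedBall hη
  have hset : S.consistent ∩ Metric.closedBall xbar η =
      Metric.closedBall xbar η ∩ (fun x => algPart (grad H x)) ⁻¹' {0} := by
    ext x
    refine ⟨fun hx => ⟨hx.2, funext ((h.algebraic_iff x hx.1.1).1 hx.1.2)⟩, fun hx => ?_⟩
    have hdom := h.subset_dom (hsub hx.1)
    exact ⟨⟨hdom, (h.algebraic_iff x hdom).2 (congrFun hx.2)⟩, hx.1⟩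
  have hcont : ContinuousOn (fun x => algPart (grad H x)) (Metric.closedBall xbar η) :=
    continuousOn_pi.2 fun k =>
      (continuous_apply (Sum.inr k)).comp_continuousOn (h.lipschitz_grad.continuousOn.mono hsub)
  rw [hset]
  exact (isCompact_closedBall xbar η).of_isClosed_subset
    (hcont.preimage_isClosed_of_isClosed Metric.isClosed_closedBall isClosed_singleton)
    inter_subset_left

-- Only `diffPart ∘ x` is known to be differentiable; the algebraic equations remove the other
-- partial derivatives of `H`, and `exists_dist_le` controls the remainder of its linearization.
theorem hasDerivWithinAt_comp (h : S.LyapunovOn H xbar r c K) {J : Set ℝ}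
    {x : ℝ → ι ⊕ κ → ℝ} (hx : S.IsSolutionOn J x)
    (hball : ∀ t ∈ J, x t ∈ Metric.closedBall xbar r) {t : ℝ} (ht : t ∈ J) :
    HasDerivWithinAt (fun s => H (x s)) (diffPart (grad H (x t)) ⬝ᵥ S.f (x t)) J t := by
  obtain ⟨C, hC⟩ := h.exists_dist_le
  have hd := hx.hasDerivWithinAt ht
  have halg := (h.algebraic_iff _ (hx.mem_dom t ht)).1 (hx.algebraic t ht)
  have hstate : (fun s => x s - x t) =O[𝓝[J] t] fun s => s - t := by
    refine (Asymptotics.IsBigO.of_bound C ?_).trans hd.hasFDerivWithinAt.isBigO_sub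
    filter_upwards [self_mem_nhdsWithin] with s hs
    simpa only [dist_eq_norm] using
      hC _ (hball s hs) _ (hball t ht) (hx.algebraic s hs) (hx.algebraic t ht)
  have hH := ((h.differentiableAt _ (hball t ht)).hasFDerivAt.isLittleO.comp_tendsto
    (hx.continuousOn t ht)).trans_isBigO hstate
  rw [hasDerivWithinAt_iff_isLittleO] at hd ⊢
  have hdot : (fun s => diffPart (grad H (x t)) ⬝ᵥ
      (diffPart (x s) - diffPart (x t) - (s - t) • S.f (x t))) =o[𝓝[J] t] fun s => s - t :=
    (Asymptotics.IsBigO.of_bound (Fintype.card ι * ‖diffPart (grad H (x t))‖)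
      (Eventually.of_forall fun s => abs_dotProduct_le _ _)).trans_isLittleO hd
  refine (hH.add hdot).congr_left fun s => ?_
  simp only [Function.comp_apply, fderiv_eq_grad_dotProduct]
  rw [dotProduct_eq_diffPart halg, dotProduct_sub, dotProduct_smul,
    show diffPart (x s - x t) = diffPart (x s) - diffPart (x t) from rfl]
  ring

theorem antitoneOn (h : S.LyapunovOn H xbar r c K) {J : Set ℝ} (hJ : J.OrdConnected)
    {x : ℝ → ι ⊕ κ → ℝ} (hx : S.IsSolutionOn J x)
    (hball : ∀ t ∈ J, x t ∈ Metric.closedBall xbar r) : AntitoneOn (fun t => H (x t)) J :=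
  have hd := fun t (ht : t ∈ J) => h.hasDerivWithinAt_comp hx hball ht
  antitoneOn_of_hasDerivWithinAt_nonpos hJ.convex (fun t ht => (hd t ht).continuousWithinAt)
    (fun t ht => (hd t (interior_subset ht)).mono interior_subset)
    fun _ ht => h.dissipation _ (hx.mem_consistent (interior_subset ht))

theorem exists_forall_Icc_dist_lt (h : S.LyapunovOn H xbar r c K) {ε : ℝ} (hε : 0 < ε) :
    ∃ δ > 0, ∀ (T : ℝ) (x : ℝ → ι ⊕ κ → ℝ), S.IsSolutionOn (Icc 0 T) x →
      dist (x 0) xbar < δ → ∀ t ∈ Icc 0 T, dist (x t) xbar < ε := by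
  wlog hεr : ε ≤ r generalizing ε
  · obtain ⟨δ, hδ, hstay⟩ := this h.r_pos le_rfl
    exact ⟨δ, hδ, fun T x hx hx0 t ht => (hstay T x hx hx0 t ht).trans (not_le.1 hεr)⟩
  obtain ⟨δ, hδ, hH⟩ := Metric.eventually_nhds_iff.1 (h.eventually_apply_lt hε)
  refine ⟨min δ ε, lt_min hδ hε, fun T x hx hx0 => ?_⟩
  refine forall_lt_of_forall_le_imp_lt
    ((continuous_id.dist continuous_const).comp_continuousOn hx.continuousOn)
    (hx0.trans_le (min_le_right _ _)) fun t ht hle => ?_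
  have hball : ∀ s ∈ Icc 0 t, x s ∈ Metric.closedBall xbar r := fun s hs => (hle s hs).trans hεr
  have hdecr := h.antitoneOn ordConnected_Icc (hx.mono (Icc_subset_Icc_right ht.2)) hball
    (left_mem_Icc.2 ht.1) (right_mem_Icc.2 ht.1) ht.1
  exact h.lt_of_apply_lt (hball t (right_mem_Icc.2 ht.1)) hε.le
    (hdecr.trans_lt (hH (hx0.trans_le (min_le_left _ _))))

-- The algebraic variables are found by minimizing `H` with the differential variables fixed; by
-- the quadratic growth of `H` the minimum is attained in the interior of the ball.
theorem exists_consistent (h : S.LyapunovOn H xbar r c K) {d : ι → ℝ}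
    (hdr : d ∈ Metric.closedBall (diffPart xbar) r)
    (hd : H (Sum.elim d (algPart xbar)) < H xbar + c / 2 * r ^ 2) :
    ∃ x ∈ Metric.closedBall xbar r, S.g x = 0 ∧ diffPart x = d := by
  have hmem := fun a (ha : a ∈ Metric.closedBall (algPart xbar) r) => sumElim_mem_closedBall hdr ha
  have hself : algPart xbar ∈ Metric.closedBall (algPart xbar) r :=
    Metric.mem_closedBall_self h.r_pos.le
  have hcont : ContinuousOn (fun a => H (Sum.elim d a)) (Metric.closedBall (algPart xbar) r) :=
    h.continuousOn.comp
      (continuous_sumElim.comp (by fun_prop : Continuous fun a => (d, a))).continuousOn hmem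
  obtain ⟨a, ha, hmin⟩ := (isCompact_closedBall (algPart xbar) r).exists_isMinOn ⟨_, hself⟩ hcont
  have hinterior : dist a (algPart xbar) < r :=
    (dist_algPart_le (Sum.elim d a) xbar).trans_lt
      (h.lt_of_apply_lt (hmem a ha) h.r_pos.le ((hmin hself).trans_lt hd))
  refine ⟨Sum.elim d a, hmem a ha, (h.algebraic_iff _ (h.subset_dom (hmem a ha))).2 ?_, rfl⟩
  exact grad_inr_eq_zero_of_isLocalMin (h.differentiableAt _ (hmem a ha))
    (hmin.isLocalMin (Metric.closedBall_mem_nhds_of_mem hinterior))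

theorem exists_forall_closedBall_consistent (h : S.LyapunovOn H xbar r c K) :
    ∃ ρ > 0, ∀ d ∈ Metric.closedBall (diffPart xbar) ρ,
      ∃ x ∈ Metric.closedBall xbar r, S.g x = 0 ∧ diffPart x = d := by
  have hlim : Tendsto (fun d => (Sum.elim d (algPart xbar) : ι ⊕ κ → ℝ)) (𝓝 (diffPart xbar))
      (𝓝 xbar) := by
    have hcont : Continuous fun d : ι → ℝ => (Sum.elim d (algPart xbar) : ι ⊕ κ → ℝ) :=
      continuous_sumElim.comp (by fun_prop : Continuous fun d => (d, algPart xbar))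
    exact hcont.tendsto' _ _ (Sum.elim_comp_inl_inr xbar)
  obtain ⟨ρ, hρ, hball⟩ := Metric.nhds_basis_closedBall.mem_iff.1
    (inter_mem (Metric.closedBall_mem_nhds (diffPart xbar) h.r_pos)
      (hlim.eventually (h.eventually_apply_lt h.r_pos)))
  exact ⟨ρ, hρ, fun d hd => h.exists_consistent (hball hd).1 (hball hd).2⟩

theorem exists_forall_dist_lt (h : S.LyapunovOn H xbar r c K) {ε : ℝ} (hε : 0 < ε) :
    ∃ δ > 0, ∀ x : ℝ → ι ⊕ κ → ℝ, S.IsSolutionOn (Ici 0) x →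
      dist (x 0) xbar < δ → ∀ t ≥ 0, dist (x t) xbar < ε := by
  obtain ⟨δ, hδ, hstay⟩ := h.exists_forall_Icc_dist_lt hε
  exact ⟨δ, hδ, fun x hx hx0 t ht =>
    hstay t x (hx.mono Icc_subset_Ici_self) hx0 t (right_mem_Icc.2 ht)⟩

theorem exists_reductionOn (h : S.LyapunovOn H xbar r c K) :
    ∃ ρ C F s, S.ReductionOn xbar r ρ C F s := by
  obtain ⟨ρ₀, hρ₀, hex⟩ := h.exists_forall_closedBall_consistent
  choose! s hsr hsg hsd using hex
  obtain ⟨C, hC⟩ := h.exists_dist_le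
  set ρ := min ρ₀ r
  have hρ : 0 < ρ := lt_min hρ₀ h.r_pos
  set B := Metric.closedBall (diffPart xbar) ρ
  have hB : B ⊆ Metric.closedBall (diffPart xbar) ρ₀ :=
    Metric.closedBall_subset_closedBall (min_le_left _ _)
  have hlip_s : LipschitzOnWith C s B := LipschitzOnWith.of_dist_le_mul fun d hd d' hd' => by
    simpa only [hsd d (hB hd), hsd d' (hB hd')] using
      hC _ (hsr d (hB hd)) _ (hsr d' (hB hd')) (hsg d (hB hd)) (hsg d' (hB hd'))
  have hlip_f : LipschitzOnWith (K * C) (fun d => S.f (s d)) B :=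
    h.lipschitz_f.comp hlip_s fun d hd => hsr d (hB hd)
  obtain ⟨p, hp_lip, hp_mem, hp_eq⟩ :=
    exists_lipschitzWith_retraction_closedBall (diffPart xbar) hρ.le
  refine ⟨ρ, C, fun d => S.f (s (p d)), s, hρ, min_le_right _ _, ⟨K * C * 1, ?_⟩, ?_, hlip_s,
    fun d hd => hsr d (hB hd), fun d hd => hsg d (hB hd), fun d hd => hsd d (hB hd),
    fun x hx hgx => ?_, fun d hd => by rw [hp_eq hd, id]⟩
  · exact lipschitzOnWith_univ.1 (hlip_f.comp hp_lip.lipschitzOnWith fun d _ => hp_mem d)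
  · obtain ⟨L, hL⟩ := (isCompact_closedBall _ ρ).exists_bound_of_continuousOn hlip_f.continuousOn
    exact ⟨L.toNNReal, fun d => (hL _ (hp_mem d)).trans (Real.le_coe_toNNReal L)⟩
  · have hdx : diffPart x ∈ Metric.closedBall (diffPart xbar) ρ₀ :=
      hB ((dist_diffPart_le x xbar).trans hx)
    have hle := hC _ (hsr _ hdx) x (Metric.closedBall_subset_closedBall (min_le_right _ _) hx)
      (hsg _ hdx) hgx
    rw [hsd _ hdx, dist_self, mul_zero] at hle
    exact dist_le_zero.1 hle

variable {ρ : ℝ} {C : NNReal} {F : (ι → ℝ) → ι → ℝ} {s : (ι → ℝ) → ι ⊕ κ → ℝ}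

theorem exists_global_solution (h : S.LyapunovOn H xbar r c K) (hR : S.ReductionOn xbar r ρ C F s) :
    ∃ δ > 0, ∀ x₀ ∈ S.consistent, dist x₀ xbar < δ →
      ∃ x : ℝ → ι ⊕ κ → ℝ, S.IsSolutionOn (Ici 0) x ∧ x 0 = x₀ := by
  obtain ⟨δ, hδ, hstay⟩ := h.exists_forall_Icc_dist_lt hR.ρ_pos
  refine ⟨min δ ρ, lt_min hδ hR.ρ_pos, fun x₀ hx₀ hdist => ?_⟩
  obtain ⟨K', hK'⟩ := hR.lipschitz_F
  obtain ⟨L, hL⟩ := hR.bounded_F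
  obtain ⟨y, hy0, hy⟩ := exists_forall_hasDerivAt_of_lipschitzWith hK' hL (diffPart x₀)
  have hx₀ρ : dist x₀ xbar < ρ := hdist.trans_le (min_le_right _ _)
  have hs0 : s (y 0) = x₀ := by rw [hy0, hR.s_diffPart _ hx₀ρ.le hx₀.2]
  have hstart : dist (s (y 0)) xbar < δ := hs0 ▸ hdist.trans_le (min_le_left _ _)
  have hcont : Continuous fun t => dist (y t) (diffPart xbar) :=
    (continuous_iff_continuousAt.2 fun t => (hy t).continuousAt).dist continuous_const
  have hin : ∀ t ∈ Ici 0, y t ∈ Metric.closedBall (diffPart xbar) ρ := by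
    intro b hb
    refine (forall_lt_of_forall_le_imp_lt hcont.continuousOn ?_ (fun T hT hle => ?_) b
      (right_mem_Icc.2 hb)).le
    · rw [hy0]
      exact (dist_diffPart_le x₀ xbar).trans_lt hx₀ρ
    · have hTT : T ∈ Icc 0 T := right_mem_Icc.2 hT.1
      have hlt := hstay T _ (hR.isSolutionOn h.subset_dom hy hle) hstart T hTT
      rw [← hR.diffPart_s _ (hle T hTT)]
      exact (dist_diffPart_le _ _).trans_lt hlt
  exact ⟨fun t => s (y t), hR.isSolutionOn h.subset_dom hy hin, hs0⟩

theorem exists_eqOn (h : S.LyapunovOn H xbar r c K) (hR : S.ReductionOn xbar r ρ C F s) :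
    ∃ δ > 0, ∀ x y : ℝ → ι ⊕ κ → ℝ, ∀ J ⊆ Ici (0 : ℝ), J.OrdConnected → 0 ∈ J →
      S.IsSolutionOn J x → S.IsSolutionOn J y → x 0 = y 0 → dist (y 0) xbar < δ → EqOn x y J := by
  obtain ⟨δ, hδ, hstay⟩ := h.exists_forall_Icc_dist_lt hR.ρ_pos
  obtain ⟨L, hL⟩ := hR.exists_dist_le_mul_exp
  refine ⟨δ, hδ, fun x y J hJ hJc h0 hx hy hxy hy0 t ht => ?_⟩
  have hsub : Icc 0 t ⊆ J := hJc.out h0 ht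
  have hle := hL t (hJ ht) x y
    (hx.mono hsub) (fun u hu => (hstay t x (hx.mono hsub) (hxy ▸ hy0) u hu).le)
    (hy.mono hsub) (fun u hu => (hstay t y (hy.mono hsub) hy0 u hu).le)
  rw [hxy, dist_self, zero_mul, mul_zero] at hle
  exact dist_le_zero.1 hle

theorem exists_tendsto_apply (h : S.LyapunovOn H xbar r c K) {x : ℝ → ι ⊕ κ → ℝ}
    (hx : S.IsSolutionOn (Ici 0) x) (hball : ∀ t ∈ Ici 0, x t ∈ Metric.closedBall xbar r) :
    ∃ V, Tendsto (fun t => H (x t)) atTop (𝓝 V) := by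
  have hanti : Antitone fun t => H (x (max t 0)) := fun a b hab =>
    h.antitoneOn ordConnected_Ici hx hball (le_max_right a 0) (le_max_right b 0)
      (max_le_max_right 0 hab)
  have hbdd : BddBelow (range fun t => H (x (max t 0))) := by
    refine ⟨H xbar, forall_mem_range.2 fun t => ?_⟩
    have hc := h.c_pos
    exact (le_add_of_nonneg_right (by positivity)).trans
      (h.quadratic_le (hball _ (le_max_right t 0)))
  refine ⟨_, (tendsto_atTop_ciInf hanti hbdd).congr' ?_⟩
  filter_upwards [eventually_ge_atTop 0] with t ht
  rw [max_eq_left ht]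

theorem tendsto_of_tendsto_apply (h : S.LyapunovOn H xbar r c K) {α : Type*} {l : Filter α}
    {x : α → ι ⊕ κ → ℝ} (hball : ∀ᶠ t in l, x t ∈ Metric.closedBall xbar r)
    (hlim : Tendsto (fun t => H (x t)) l (𝓝 (H xbar))) : Tendsto x l (𝓝 xbar) := by
  refine Metric.tendsto_nhds.2 fun ε hε => ?_
  have hc := h.c_pos
  filter_upwards [hball, hlim.eventually
    (gt_mem_nhds (lt_add_of_pos_right _ (by positivity : 0 < c / 2 * ε ^ 2)))] with t ht hlt
  exact h.lt_of_apply_lt ht hε.le hlt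

theorem apply_zero_eq_of_conserved (h : S.LyapunovOn H xbar r c K) {x : ℝ → ι ⊕ κ → ℝ}
    (hx : S.IsSolutionOn (Ici 0) x) (hball : ∀ t ∈ Ici 0, x t ∈ Metric.closedBall xbar r) {V : ℝ}
    (hV : ∀ t ∈ Ici 0, H (x t) = V) : x 0 = xbar := by
  refine h.eq_of_grad_eq_zero (hball 0 self_mem_Ici) (h.detectable x hx fun t ht => ?_)
  exact (uniqueDiffOn_Ici 0 t ht).eq_deriv _ (h.hasDerivWithinAt_comp hx hball ht)
    ((hasDerivWithinAt_const t (Ici 0) V).congr_of_mem hV ht)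

-- The invariance principle: `H` takes its limit `V` along `x` on the whole solution `y` issuing
-- from a limit point of `x`.
theorem apply_zero_eq_of_tendsto (h : S.LyapunovOn H xbar r c K)
    (hR : S.ReductionOn xbar r ρ C F s) {x y : ℝ → ι ⊕ κ → ℝ}
    (hx : S.IsSolutionOn (Ici 0) x) (hxb : ∀ t ∈ Ici 0, x t ∈ Metric.closedBall xbar ρ)
    (hy : S.IsSolutionOn (Ici 0) y) (hyb : ∀ t ∈ Ici 0, y t ∈ Metric.closedBall xbar ρ)
    {V : ℝ} (hV : Tendsto (fun t => H (x t)) atTop (𝓝 V)) {u : ℕ → ℝ} (hu : ∀ n, 0 ≤ u n)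
    (hu_lim : Tendsto u atTop atTop) (hlim : Tendsto (fun n => x (u n)) atTop (𝓝 (y 0))) :
    y 0 = xbar := by
  have hyr : ∀ t ∈ Ici 0, y t ∈ Metric.closedBall xbar r := fun t ht =>
    Metric.closedBall_subset_closedBall hR.ρ_le (hyb t ht)
  refine h.apply_zero_eq_of_conserved hy hyr (V := V) fun t ht => ?_
  have hH : Tendsto (fun n => H (x (t + u n))) atTop (𝓝 (H (y t))) :=
    (h.differentiableAt _ (hyr t ht)).continuousAt.tendsto.comp
      (hR.tendsto_add hx hxb hy hyb hu hlim ht)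
  exact tendsto_nhds_unique hH (hV.comp (tendsto_atTop_add_const_left _ t hu_lim))

theorem exists_forall_tendsto (h : S.LyapunovOn H xbar r c K) (hR : S.ReductionOn xbar r ρ C F s) :
    ∃ δ > 0, ∀ x, S.IsSolutionOn (Ici 0) x → dist (x 0) xbar < δ → Tendsto x atTop (𝓝 xbar) := by
  obtain ⟨δ₁, hδ₁, hstay₁⟩ := h.exists_forall_dist_lt hR.ρ_pos
  obtain ⟨δ₂, hδ₂, hexists⟩ := h.exists_global_solution hR
  obtain ⟨η, hη, hη_lt⟩ := exists_between (lt_min hδ₁ (lt_min hδ₂ hR.ρ_pos))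
  obtain ⟨hη₁, hη₂, hηρ⟩ : η < δ₁ ∧ η < δ₂ ∧ η < ρ := by simpa only [lt_min_iff] using hη_lt
  have hηr : η ≤ r := hηρ.le.trans hR.ρ_le
  obtain ⟨δ, hδ, hstay⟩ := h.exists_forall_dist_lt hη
  refine ⟨δ, hδ, fun x hx hx0 => ?_⟩
  have hxη : ∀ t ∈ Ici 0, x t ∈ Metric.closedBall xbar η := fun t ht => (hstay x hx hx0 t ht).le
  have hxr : ∀ t ∈ Ici 0, x t ∈ Metric.closedBall xbar r := fun t ht => (hxη t ht).trans hηr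
  obtain ⟨V, hV⟩ := h.exists_tendsto_apply hx hxr
  obtain ⟨p, ⟨hp, hpη⟩, φ, hφ, hlim⟩ :=
    (h.isCompact_consistent_inter_closedBall hηr).tendsto_subseq (x := fun n : ℕ => x n)
      fun n => have hn := mem_Ici.2 n.cast_nonneg; ⟨hx.mem_consistent hn, hxη n hn⟩
  obtain ⟨y, hy, rfl⟩ := hexists p hp (lt_of_le_of_lt hpη hη₂)
  have hφ_lim : Tendsto (fun n => (φ n : ℝ)) atTop atTop :=
    tendsto_natCast_atTop_atTop.comp hφ.tendsto_atTop
  have hyx : y 0 = xbar := h.apply_zero_eq_of_tendsto hR hx (fun t ht => (hxη t ht).trans hηρ.le)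
    hy (fun t ht => (hstay₁ y hy (lt_of_le_of_lt hpη hη₁) t ht).le) hV
    (fun n => (φ n).cast_nonneg) hφ_lim hlim
  have hHp : Tendsto (fun n => H (x (φ n))) atTop (𝓝 (H xbar)) :=
    (h.differentiableAt _ h.mem_closedBall_self).continuousAt.tendsto.comp (hyx ▸ hlim)
  rw [tendsto_nhds_unique (hV.comp hφ_lim) hHp] at hV
  exact h.tendsto_of_tendsto_apply ((eventually_ge_atTop 0).mono hxr) hV

theorem locallyAsymptoticallyStable (h : S.LyapunovOn H xbar r c K)
    (heq : S.IsEquilibrium xbar) : S.LocallyAsymptoticallyStable xbar := by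
  obtain ⟨ρ, C, F, s, hR⟩ := h.exists_reductionOn
  refine ⟨heq, ?_, fun ε hε => h.exists_forall_dist_lt hε, h.exists_forall_tendsto hR⟩
  obtain ⟨δ₁, hδ₁, hexists⟩ := h.exists_global_solution hR
  obtain ⟨δ₂, hδ₂, hunique⟩ := h.exists_eqOn hR
  refine ⟨min δ₁ δ₂, lt_min hδ₁ hδ₂, fun x₀ hx₀ hdist => ?_⟩
  obtain ⟨x, hx, rfl⟩ := hexists x₀ hx₀ (hdist.trans_le (min_le_left _ _))
  exact ⟨x, hx, rfl, fun J y hJ hJc h0 hy hy0 =>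
    hunique y x J hJ hJc h0 hy (hx.mono hJ) hy0 (hdist.trans_le (min_le_right _ _))⟩

end LyapunovOn

theorem exists_lyapunovOn {S : DAE ι κ} {H : (ι ⊕ κ → ℝ) → ℝ} {xbar : ι ⊕ κ → ℝ}
    (hdom : S.dom ∈ 𝓝 xbar) (hH : ContDiffAt ℝ 2 H xbar) (hf : ContDiffAt ℝ 1 S.f xbar)
    (hess_pos : (hess H xbar).PosDef) (grad_eq_zero : grad H xbar = 0)
    (algebraic_iff : ∀ x ∈ S.dom, S.g x = 0 ↔ ∀ k, grad H x (.inr k) = 0)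
    (dissipation : ∀ x ∈ S.consistent, diffPart (grad H x) ⬝ᵥ S.f x ≤ 0)
    (detectable : ∀ x, S.IsSolutionOn (Ici 0) x →
      (∀ t ≥ 0, diffPart (grad H (x t)) ⬝ᵥ S.f (x t) = 0) → grad H (x 0) = 0) :
    ∃ r c K, S.LyapunovOn H xbar r c K := by
  obtain ⟨c, hc, u₀, hu₀, hmono⟩ := exists_strongMonoOn_grad_of_posDef_hess hH hess_pos
  obtain ⟨K₁, u₁, hu₁, hK₁⟩ := ((contDiffAt_grad hH (m := 1) (by norm_num)).hasStrictFDerivAt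
    one_ne_zero).exists_lipschitzOnWith
  obtain ⟨K₂, u₂, hu₂, hK₂⟩ := (hf.hasStrictFDerivAt one_ne_zero).exists_lipschitzOnWith
  have hdiff : {x | DifferentiableAt ℝ H x} ∈ 𝓝 xbar :=
    (hH.eventually (by simp)).mono fun x hx => hx.differentiableAt two_ne_zero
  obtain ⟨r, hr, hball⟩ := Metric.nhds_basis_closedBall.mem_iff.1
    (inter_mem (inter_mem hu₀ (inter_mem hu₁ hu₂)) (inter_mem hdom hdiff))
  exact ⟨r, c, max K₁ K₂,
    { r_pos := hr
      c_pos := hc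
      subset_dom := fun x hx => (hball hx).2.1
      differentiableAt := fun x hx => (hball hx).2.2
      lipschitz_grad := (hK₁.mono fun x hx => (hball hx).1.2.1).weaken (le_max_left _ _)
      lipschitz_f := (hK₂.mono fun x hx => (hball hx).1.2.2).weaken (le_max_right _ _)
      strongMono := hmono.mono fun x hx => (hball hx).1.1
      grad_eq_zero := grad_eq_zero
      algebraic_iff := algebraic_iff
      dissipation := dissipation
      detectable := detectable }⟩

end DAE

/-! ### Incidence matrices of trees -/

section Incidence

variable {V K : Type} {D : Matrix V K ℝ}

theorem mulVec_injective_of_rank_eq_card [Fintype K] (h : D.rank = Fintype.card K) :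
    Function.Injective D.mulVec := by
  have hdim := D.mulVecLin.finrank_range_add_finrank_ker
  rw [Module.finrank_fintype_fun_eq_card, show Module.finrank ℝ _ = D.rank from rfl, h,
    Nat.add_eq_left, Submodule.finrank_eq_zero] at hdim
  exact LinearMap.ker_eq_bot.1 hdim

namespace IsTreeIncidence

variable [DecidableEq V]

theorem transpose_mulVec_eq_zero_iff [Fintype V] (hD : IsTreeIncidence D) (u : V → ℝ) :
    Dᵀ *ᵥ u = 0 ↔ ∀ i j, u i = u j := by
  obtain ⟨T, tail, head, hT, hbij, hDk⟩ := hD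
  have hcol : ∀ k, (Dᵀ *ᵥ u) k = u (head k) - u (tail k) := fun k => by
    simp [mulVec, dotProduct, hDk, sub_mul]
  refine ⟨fun hu => ?_, fun hu => funext fun k => by rw [hcol, hu, sub_self, Pi.zero_apply]⟩
  have hadj : ∀ i j, T.Adj i j → u i = u j := by
    intro i j hij
    obtain ⟨k, -, hk⟩ := hbij.surjOn (show s(i, j) ∈ T.edgeSet from hij)
    have hedge : u (head k) = u (tail k) := sub_eq_zero.1 ((hcol k).symm.trans (congrFun hu k))
    rcases Sym2.eq_iff.1 hk with ⟨rfl, rfl⟩ | ⟨rfl, rfl⟩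
    exacts [hedge.symm, hedge]
  intro i j
  obtain ⟨w⟩ := hT.connected.preconnected i j
  induction w with
  | nil => rfl
  | cons hij _ ih => exact (hadj _ _ hij).trans ih

theorem card_add_one [Fintype V] [Fintype K] (hD : IsTreeIncidence D) :
    Fintype.card K + 1 = Fintype.card V := by
  classical
  obtain ⟨T, tail, head, hT, hbij, -⟩ := hD
  rw [← hT.card_edgeFinset, ← Set.ncard_coe_finset, SimpleGraph.coe_edgeFinset, ← hbij.ncard_eq,
    Set.ncard_univ, Nat.card_eq_fintype_card]

theorem mulVec_injective [Finite V] [Fintype K] (hD : IsTreeIncidence D) :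
    Function.Injective D.mulVec := by
  have := Fintype.ofFinite V
  refine mulVec_injective_of_rank_eq_card (le_antisymm D.rank_le_card_width ?_)
  have hspan : LinearMap.ker Dᵀ.mulVecLin ≤ Submodule.span ℝ {fun _ => (1 : ℝ)} := fun u hu => by
    have hconst := (hD.transpose_mulVec_eq_zero_iff u).1 hu
    obtain ⟨T, tail, head, hT, -⟩ := hD
    obtain ⟨i₀⟩ := hT.connected.nonempty
    exact Submodule.mem_span_singleton.2 ⟨u i₀, funext fun i => by simp [hconst i i₀]⟩
  have hker : Module.finrank ℝ (LinearMap.ker Dᵀ.mulVecLin) ≤ 1 :=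
    (Submodule.finrank_mono hspan).trans ((finrank_span_le_card _).trans (by simp))
  have hdim := Dᵀ.mulVecLin.finrank_range_add_finrank_ker
  rw [Module.finrank_fintype_fun_eq_card, show Module.finrank ℝ _ = Dᵀ.rank from rfl,
    rank_transpose, ← hD.card_add_one] at hdim
  lia

end IsTreeIncidence

end Incidence

/-! ### The shifted Hamiltonian -/

theorem hasFDerivAt_dotProduct_sub_dotProduct_log {ι : Type} [Fintype ι] (b q : ι → ℝ)
    {v : ι → ℝ} (hv : ∀ i, v i ≠ 0) :
    HasFDerivAt (fun v : ι → ℝ => v ⬝ᵥ b - q ⬝ᵥ fun i => Real.log (v i))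
      (∑ i, (b i - q i / v i) • ContinuousLinearMap.proj (R := ℝ) (φ := fun _ => ℝ) i) v := by
  have hi : ∀ i, HasFDerivAt (fun v : ι → ℝ => v i * b i - q i * Real.log (v i))
      ((b i - q i / v i) • ContinuousLinearMap.proj (R := ℝ) (φ := fun _ => ℝ) i) v := by
    intro i
    have hproj := hasFDerivAt_apply (𝕜 := ℝ) (F' := fun _ => ℝ) i v
    refine ((hproj.mul_const (b i)).sub ((hproj.log (hv i)).const_mul (q i))).congr_fderiv ?_
    rw [smul_smul, ← sub_smul, div_eq_mul_inv]
  have hsum := HasFDerivAt.fun_sum fun i (_ : i ∈ Finset.univ) => hi i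
  simpa only [dotProduct, Finset.sum_sub_distrib] using hsum

section Blocks

variable {ng nl mc : ℕ}

theorem dotProduct_colC (w : CIdx ng nl mc → ℝ) (a : Fin ng → ℝ) (b : Fin nl → ℝ)
    (c : Fin mc → ℝ) (d : Fin ng → ℝ) (e : Fin nl → ℝ) :
    w ⬝ᵥ colC a b c d e =
      cG w ⬝ᵥ a + (cL w ⬝ᵥ b + (cV w ⬝ᵥ c + (cLamG w ⬝ᵥ d + cLamL w ⬝ᵥ e))) := by
  simp only [dotProduct, Fintype.sum_sum_type]
  rfl

theorem diffPart_dotProduct_colD (h : State ng nl mc) (c : CIdx ng nl mc → ℝ)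
    (φ : Fin (ng + nl - 1) → ℝ) (p e : Fin ng → ℝ) :
    DAE.diffPart h ⬝ᵥ colD c φ p e =
      xC h ⬝ᵥ c + (xPhi h ⬝ᵥ φ + (xP h ⬝ᵥ p + xEg h ⬝ᵥ e)) := by
  simp only [dotProduct, Fintype.sum_sum_type]
  rfl

theorem colC_add (a a' : Fin ng → ℝ) (b b' : Fin nl → ℝ) (c c' : Fin mc → ℝ) (d d' : Fin ng → ℝ)
    (e e' : Fin nl → ℝ) :
    colC a b c d e + colC a' b' c' d' e' = colC (a + a') (b + b') (c + c') (d + d') (e + e') := by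
  simp only [colC, ← Sum.elim_add_add]

theorem colC_eq_zero_iff {a : Fin ng → ℝ} {b : Fin nl → ℝ} {c : Fin mc → ℝ} {d : Fin ng → ℝ}
    {e : Fin nl → ℝ} : colC a b c d e = 0 ↔ a = 0 ∧ b = 0 ∧ c = 0 ∧ d = 0 ∧ e = 0 := by
  simp only [colC, funext_iff, Sum.forall, Sum.elim_inl, Sum.elim_inr, Pi.zero_apply]

theorem colD_eq_zero_iff {c : CIdx ng nl mc → ℝ} {φ : Fin (ng + nl - 1) → ℝ} {p e : Fin ng → ℝ} :
    colD c φ p e = 0 ↔ c = 0 ∧ φ = 0 ∧ p = 0 ∧ e = 0 := by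
  simp only [colD, funext_iff, Sum.forall, Sum.elim_inl, Sum.elim_inr, Pi.zero_apply, and_assoc]

theorem contDiff_cG {n : WithTop ℕ∞} : ContDiff ℝ n (cG : (CIdx ng nl mc → ℝ) → Fin ng → ℝ) :=
  contDiff_pi.2 fun _ => contDiff_apply ℝ ℝ _

theorem contDiff_cL {n : WithTop ℕ∞} : ContDiff ℝ n (cL : (CIdx ng nl mc → ℝ) → Fin nl → ℝ) :=
  contDiff_pi.2 fun _ => contDiff_apply ℝ ℝ _

theorem xEl_pos {x : State ng nl mc} (hx : ∀ i, 0 < xE x i) (i : Fin nl) : 0 < xEl x i :=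
  hx (.inr i)

end Blocks

namespace Model

variable {ng nl mc : ℕ} (S : Model ng nl mc)

/-- The assumptions on the parameters and on the functions `C`, `U` under which the shifted
Hamiltonian is a Lyapunov function. -/
structure Regular : Prop where
  A_pos : ∀ i, 0 < S.A i
  M_pos : ∀ i, 0 < S.M i
  T_pos : ∀ i, 0 < S.T i
  Xd_gt : ∀ i, S.Xd' i < S.Xd i
  Dhat_injective : Function.Injective S.Dhat.mulVec
  C_smooth : ContDiff ℝ 2 S.C
  U_smooth : ContDiff ℝ 2 S.U
  C_convex : StrictConvexOn ℝ univ S.C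
  U_concave : StrictConcaveOn ℝ univ S.U
  τg_pos : S.τg.PosDef
  τl_pos : S.τl.PosDef
  τv_pos : S.τv.PosDef
  τlamg_pos : S.τlamg.PosDef
  τlaml_pos : S.τlaml.PosDef

variable {S}

theorem Standing.regular (hS : S.Standing) : S.Regular where
  __ := hS
  Dhat_injective := mulVec_injective_of_rank_eq_card (by rw [hS.Dhat_rank, Fintype.card_fin])

theorem Regular.transpose_τc (hS : S.Regular) : S.τcᵀ = S.τc := by
  have transpose_eq : ∀ {n : Type} [Fintype n] {A : Matrix n n ℝ}, A.PosDef → Aᵀ = A :=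
    fun hA => by simpa using hA.isHermitian.eq
  simp only [τc, fromBlocks_transpose, transpose_zero, transpose_eq hS.τg_pos,
    transpose_eq hS.τl_pos, transpose_eq hS.τv_pos, transpose_eq hS.τlamg_pos,
    transpose_eq hS.τlaml_pos]

theorem Regular.isUnit_det_τc (hS : S.Regular) : IsUnit S.τc.det := by
  simp only [τc, det_fromBlocks_zero₂₁, isUnit_iff_ne_zero]
  exact mul_ne_zero hS.τg_pos.det_pos.ne' <| mul_ne_zero hS.τl_pos.det_pos.ne' <|
    mul_ne_zero hS.τv_pos.det_pos.ne' <| mul_ne_zero hS.τlamg_pos.det_pos.ne'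
      hS.τlaml_pos.det_pos.ne'

theorem Regular.τc_mulVec_zc (hS : S.Regular) (x : State ng nl mc) : S.τc *ᵥ S.zc x = xC x := by
  rw [zc, mulVec_mulVec, mul_nonsing_inv _ hS.isUnit_det_τc, one_mulVec]

variable (S)

theorem τc_mulVec (w : CIdx ng nl mc → ℝ) :
    S.τc *ᵥ w = colC (S.τg *ᵥ cG w) (S.τl *ᵥ cL w) (S.τv *ᵥ cV w) (S.τlamg *ᵥ cLamG w)
      (S.τlaml *ᵥ cLamL w) := by
  simp only [τc, fromBlocks_mulVec, zero_mulVec, add_zero, zero_add]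
  rfl

theorem contDiff_zc {n : WithTop ℕ∞} : ContDiff ℝ n S.zc := by
  unfold zc mulVec dotProduct xC
  fun_prop

theorem contDiff_Hp {n : WithTop ℕ∞} : ContDiff ℝ n S.Hp := by
  have contDiff_xE : ∀ i, ContDiff ℝ n fun x : State ng nl mc => xE x i := by
    rintro (i | i)
    · exact contDiff_apply ℝ ℝ _
    · exact contDiff_apply ℝ ℝ _
  have contDiff_angle : ∀ i, ContDiff ℝ n fun x : State ng nl mc => S.angle (xPhi x) i := by
    intro i
    unfold angle mulVec dotProduct xPhi
    fun_prop
  unfold Hp xP xEg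
  fun_prop

theorem contDiff_Hc {n : WithTop ℕ∞} : ContDiff ℝ n S.Hc := by
  unfold Hc mulVec dotProduct xC
  fun_prop

/-- The kinetic energy `½ p_gᵀ M⁻¹ p_g` of the generators: the part of `H_p` that depends on the
momenta. -/
def kinetic (x : State ng nl mc) : ℝ :=
  1 / 2 * (xP x ⬝ᵥ (diagonal (fun i => (S.M i)⁻¹) *ᵥ xP x))

theorem contDiff_kinetic {n : WithTop ℕ∞} : ContDiff ℝ n S.kinetic := by
  unfold kinetic mulVec dotProduct xP
  fun_prop

theorem xC_grad_Hp (x : State ng nl mc) : xC (grad S.Hp x) = 0 := by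
  ext i
  refine grad_apply_eq_zero_of_forall_add_smul_single fun y t => ?_
  have hP : xP (y + t • Pi.single (.inl (.inl i)) 1) = xP y := by ext j; simp [xP]
  have hEg : xEg (y + t • Pi.single (.inl (.inl i)) 1) = xEg y := by ext j; simp [xEg]
  have hEl : xEl (y + t • Pi.single (.inl (.inl i)) 1) = xEl y := by ext j; simp [xEl]
  have hPhi : xPhi (y + t • Pi.single (.inl (.inl i)) 1) = xPhi y := by ext j; simp [xPhi]
  simp only [Hp, xE, hP, hEg, hEl, hPhi]

theorem xP_grad_Hp_sub_kinetic (x : State ng nl mc) :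
    xP (grad (fun y => S.Hp y - S.kinetic y) x) = 0 := by
  ext i
  refine grad_apply_eq_zero_of_forall_add_smul_single fun y t => ?_
  set y' : State ng nl mc := y + t • Pi.single (.inl (.inr (.inr (.inl i)))) 1 with hy'
  have hEg : xEg y' = xEg y := by ext j; simp [xEg, hy']
  have hEl : xEl y' = xEl y := by ext j; simp [xEl, hy']
  have hPhi : xPhi y' = xPhi y := by ext j; simp [xPhi, hy']
  have hkin : ∀ z : State ng nl mc, S.kinetic z = 1 / 2 * ∑ i, (S.M i)⁻¹ * xP z i ^ 2 := by
    intro z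
    simp only [kinetic, dotProduct, mulVec_diagonal]
    congr! 2
    ring
  simp only [Hp, hkin, xE, hEg, hEl, hPhi, Finset.sum_add_distrib]
  ring

theorem xP_grad_kinetic (x : State ng nl mc) : xP (grad S.kinetic x) = S.omegaG x := by
  have hquad : ContDiff ℝ 1 fun p : Fin ng → ℝ =>
      1 / 2 * (p ⬝ᵥ (diagonal (fun i => (S.M i)⁻¹) *ᵥ p)) := by
    unfold mulVec dotProduct
    fun_prop
  ext i
  refine (grad_comp_reindex_apply
    (e := fun i : Fin ng => (.inl (.inr (.inr (.inl i))) : XIdx ng nl mc))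
    (fun _ _ h => by simpa using h) (hquad.differentiable one_ne_zero _) i).trans ?_
  rw [grad_half_quadratic (diagonal_transpose _), mulVec_diagonal]
  rfl

theorem xP_grad_Hp (x : State ng nl mc) : xP (grad S.Hp x) = S.omegaG x := by
  have hsub := grad_sub (S.contDiff_Hp.differentiable one_ne_zero x)
    (S.contDiff_kinetic.differentiable one_ne_zero x)
  have hzero := S.xP_grad_Hp_sub_kinetic x
  rw [hsub] at hzero
  exact (sub_eq_zero.1 hzero).trans (S.xP_grad_kinetic x)

theorem Regular.xC_grad_Hc {S : Model ng nl mc} (hS : S.Regular) (x : State ng nl mc) :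
    xC (grad S.Hc x) = S.zc x := by
  have hquad : ContDiff ℝ 1 fun z : CIdx ng nl mc → ℝ => 1 / 2 * (z ⬝ᵥ (S.τc⁻¹ *ᵥ z)) := by
    unfold mulVec dotProduct
    fun_prop
  ext i
  refine (grad_comp_reindex_apply (e := fun i : CIdx ng nl mc => (.inl (.inl i) : XIdx ng nl mc))
    (fun _ _ h => by simpa using h) (hquad.differentiable one_ne_zero _) i).trans ?_
  rw [grad_half_quadratic (by rw [transpose_nonsing_inv, hS.transpose_τc])]
  rfl

theorem grad_Hc_apply_eq_zero (x : State ng nl mc) {j : XIdx ng nl mc}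
    (hj : ∀ i, j ≠ .inl (.inl i)) : grad S.Hc x j = 0 :=
  grad_comp_reindex_apply_eq_zero (F := fun z => 1 / 2 * (z ⬝ᵥ (S.τc⁻¹ *ᵥ z)))
    (e := fun i : CIdx ng nl mc => (.inl (.inl i) : XIdx ng nl mc))
    fun ⟨i, hi⟩ => hj i hi.symm

theorem contDiffAt_Habar {n : WithTop ℕ∞} (xbar : State ng nl mc) {x : State ng nl mc}
    (hx : ∀ i, 0 < xEl x i) : ContDiffAt ℝ n (S.Habar xbar) x := by
  have contDiffAt_log : ∀ i, ContDiffAt ℝ n (fun x : State ng nl mc => Real.log (xEl x i)) x :=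
    fun i => (contDiff_apply ℝ ℝ _).contDiffAt.log (hx i).ne'
  have contDiff_xEl : ∀ i, ContDiff ℝ n (fun x : State ng nl mc => xEl x i) :=
    fun i => contDiff_apply ℝ ℝ _
  unfold Habar dotProduct
  fun_prop

theorem grad_Habar_inl (xbar x : State ng nl mc) (j : DIdx ng nl mc) :
    grad (S.Habar xbar) x (.inl j) = 0 :=
  grad_comp_reindex_apply_eq_zero
    (F := fun v => v ⬝ᵥ xEl (grad S.Hp xbar) - S.Q ⬝ᵥ fun i => Real.log (v i))
    (e := (Sum.inr : Fin nl → XIdx ng nl mc)) (by simp)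

theorem xEl_grad_Habar (xbar : State ng nl mc) {x : State ng nl mc} (hx : ∀ i, 0 < xEl x i)
    (i : Fin nl) :
    xEl (grad (S.Habar xbar) x) i = xEl (grad S.Hp xbar) i - S.Q i / xEl x i := by
  have hderiv := hasFDerivAt_dotProduct_sub_dotProduct_log (xEl (grad S.Hp xbar)) S.Q
    fun i => (hx i).ne'
  refine (grad_comp_reindex_apply (e := (Sum.inr : Fin nl → XIdx ng nl mc)) Sum.inr_injective
    hderiv.differentiableAt i).trans ?_
  refine (congrFun (grad_eq_of_hasFDerivAt hderiv) i).trans ?_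
  simp [Pi.single_apply]

variable (xbar : State ng nl mc) {x : State ng nl mc}

theorem contDiffAt_Hbar {n : WithTop ℕ∞} (hx : ∀ i, 0 < xE x i) :
    ContDiffAt ℝ n (S.Hbar xbar) x :=
  ((contDiff_shifted S.contDiff_Hp xbar).contDiffAt.add
    (S.contDiffAt_Habar xbar (xEl_pos hx))).add (contDiff_shifted S.contDiff_Hc xbar).contDiffAt

theorem grad_Hbar (hx : ∀ i, 0 < xE x i) :
    grad (S.Hbar xbar) x =
      (grad S.Hp x - grad S.Hp xbar) + grad (S.Habar xbar) x + (grad S.Hc x - grad S.Hc xbar) := by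
  have hp : DifferentiableAt ℝ S.Hp x := S.contDiff_Hp.differentiable one_ne_zero x
  have hc : DifferentiableAt ℝ S.Hc x := S.contDiff_Hc.differentiable one_ne_zero x
  have ha : DifferentiableAt ℝ (S.Habar xbar) x :=
    (S.contDiffAt_Habar xbar (xEl_pos hx)).differentiableAt one_ne_zero
  have hps := differentiableAt_shifted hp xbar
  rw [← grad_shifted hp, ← grad_shifted hc, ← grad_add hps ha]
  exact grad_add (hps.add ha) (differentiableAt_shifted hc xbar)

theorem Regular.xC_grad_Hbar {S : Model ng nl mc} (hS : S.Regular) (hx : ∀ i, 0 < xE x i) :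
    xC (grad (S.Hbar xbar) x) = S.zc x - S.zc xbar := by
  rw [← hS.xC_grad_Hc, ← hS.xC_grad_Hc, S.grad_Hbar xbar hx]
  ext i
  have hp := congrFun (S.xC_grad_Hp x) i
  have hpbar := congrFun (S.xC_grad_Hp xbar) i
  simp only [xC, Pi.zero_apply] at hp hpbar
  simp [xC, hp, hpbar, S.grad_Habar_inl]

theorem xPhi_grad_Hbar (hx : ∀ i, 0 < xE x i) :
    xPhi (grad (S.Hbar xbar) x) = xPhi (grad S.Hp x) - xPhi (grad S.Hp xbar) := by
  rw [S.grad_Hbar xbar hx]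
  ext i
  simp [xPhi, S.grad_Habar_inl, S.grad_Hc_apply_eq_zero]

theorem xP_grad_Hbar (hx : ∀ i, 0 < xE x i) :
    xP (grad (S.Hbar xbar) x) = S.omegaG x - S.omegaG xbar := by
  rw [← S.xP_grad_Hp, ← S.xP_grad_Hp, S.grad_Hbar xbar hx]
  ext i
  simp [xP, S.grad_Habar_inl, S.grad_Hc_apply_eq_zero]

theorem xEg_grad_Hbar (hx : ∀ i, 0 < xE x i) :
    xEg (grad (S.Hbar xbar) x) = xEg (grad S.Hp x) - xEg (grad S.Hp xbar) := by
  rw [S.grad_Hbar xbar hx]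
  ext i
  simp [xEg, S.grad_Habar_inl, S.grad_Hc_apply_eq_zero]

theorem xEl_grad_Hbar (hx : ∀ i, 0 < xE x i) (i : Fin nl) :
    xEl (grad (S.Hbar xbar) x) i = xEl (grad S.Hp x) i - S.Q i / xEl x i := by
  have ha := S.xEl_grad_Habar xbar (xEl_pos hx) i
  simp only [xEl] at ha
  simp [xEl, S.grad_Hbar xbar hx, ha, S.grad_Hc_apply_eq_zero]

theorem contDiff_welfare {n : WithTop ℕ∞} (hC : ContDiff ℝ n S.C) (hU : ContDiff ℝ n S.U) :
    ContDiff ℝ n S.welfare :=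
  (hU.comp contDiff_cL).sub (hC.comp contDiff_cG)

theorem grad_welfare (hC : Differentiable ℝ S.C) (hU : Differentiable ℝ S.U)
    (z : CIdx ng nl mc → ℝ) :
    grad S.welfare z = colC (-grad S.C (cG z)) (grad S.U (cL z)) 0 0 0 := by
  set eG : Fin ng → CIdx ng nl mc := Sum.inl
  set eL : Fin nl → CIdx ng nl mc := fun i => .inr (.inl i)
  have hdiffC : DifferentiableAt ℝ (fun z : CIdx ng nl mc → ℝ => S.C (cG z)) z :=
    (hC _).comp z (contDiff_cG.differentiable one_ne_zero z)
  have hdiffU : DifferentiableAt ℝ (fun z : CIdx ng nl mc → ℝ => S.U (cL z)) z :=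
    (hU _).comp z (contDiff_cL.differentiable one_ne_zero z)
  have hCG : ∀ i, grad (fun z : CIdx ng nl mc → ℝ => S.C (cG z)) z (eG i) = grad S.C (cG z) i :=
    grad_comp_reindex_apply Sum.inl_injective (hC _)
  have hUL : ∀ i, grad (fun z : CIdx ng nl mc → ℝ => S.U (cL z)) z (eL i) = grad S.U (cL z) i :=
    grad_comp_reindex_apply (fun _ _ h => by simpa [eL] using h) (hU _)
  have hC0 : ∀ j, j ∉ range eG → grad (fun z : CIdx ng nl mc → ℝ => S.C (cG z)) z j = 0 :=
    fun j hj => grad_comp_reindex_apply_eq_zero hj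
  have hU0 : ∀ j, j ∉ range eL → grad (fun z : CIdx ng nl mc → ℝ => S.U (cL z)) z j = 0 :=
    fun j hj => grad_comp_reindex_apply_eq_zero hj
  refine (grad_sub hdiffU hdiffC).trans ?_
  ext (i | i | i | i | i)
  · simpa [hU0, eL, colC] using hCG i
  · simpa [hC0, eG, colC] using hUL i
  all_goals simp [hC0, hU0, eG, eL, colC]

end Model

/-! ### Dissipation of energy -/

namespace Model

variable {ng nl mc : ℕ} (S : Model ng nl mc)

theorem dotProduct_Jc (w : CIdx ng nl mc → ℝ) : w ⬝ᵥ S.Jc w = 0 := by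
  simp only [Jc, dotProduct_colC, dotProduct_add, dotProduct_sub, dotProduct_neg,
    dotProduct_transpose_mulVec]
  rw [dotProduct_comm (cG w) (cLamG w), dotProduct_comm (cL w) (cLamL w)]
  ring

/-- The residual `∇_{P_l} H̄ + D̂_l ∇_φ H̄` of the load power balance for a gradient `h = ∇H̄`; by
the algebraic equation eliminated in the shifted system it equals `-A_l (ω_l - ω̄_l)`. -/
def loadResidual (h : State ng nl mc) : Fin nl → ℝ :=
  cL (xC h) + S.Dhat.toRows₂ *ᵥ xPhi h

theorem diffPart_grad_dotProduct_f (xbar x : State ng nl mc) :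
    let h := grad (S.Hbar xbar) x
    DAE.diffPart h ⬝ᵥ (S.shiftedSystem xbar).f x =
      xC h ⬝ᵥ (grad S.welfare (S.zc x) - grad S.welfare (S.zc xbar))
      - S.loadResidual h ⬝ᵥ (S.Al⁻¹ *ᵥ S.loadResidual h)
      - xP h ⬝ᵥ (S.Ag *ᵥ xP h) - xEg h ⬝ᵥ (S.Rg *ᵥ xEg h) := by
  simp only [shiftedSystem, loadResidual]
  generalize grad (S.Hbar xbar) x = h
  rw [diffPart_dotProduct_colD, dotProduct_add (xC h), dotProduct_add (xC h), dotProduct_Jc,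
    dotProduct_colC]
  simp only [dotProduct_add, dotProduct_sub, dotProduct_neg, dotProduct_zero, add_dotProduct,
    mulVec_add, dotProduct_transpose_mulVec]
  rw [dotProduct_comm (cG (xC h)) (xP h),
    dotProduct_comm (S.Al⁻¹ *ᵥ cL (xC h)) (S.Dhat.toRows₂ *ᵥ xPhi h),
    dotProduct_comm (S.Al⁻¹ *ᵥ S.Dhat.toRows₂ *ᵥ xPhi h) (S.Dhat.toRows₂ *ᵥ xPhi h)]
  ring

theorem dotProduct_grad_welfare_sub (hC : Differentiable ℝ S.C) (hU : Differentiable ℝ S.U)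
    (z z' : CIdx ng nl mc → ℝ) :
    (z - z') ⬝ᵥ (grad S.welfare z - grad S.welfare z') =
      -((grad S.C (cG z) - grad S.C (cG z')) ⬝ᵥ (cG z - cG z'))
      - (grad (-S.U) (cL z) - grad (-S.U) (cL z')) ⬝ᵥ (cL z - cL z') := by
  have hblocks : grad S.welfare z - grad S.welfare z' =
      colC (-(grad S.C (cG z) - grad S.C (cG z')))
        (-(grad (-S.U) (cL z) - grad (-S.U) (cL z'))) 0 0 0 := by
    simp only [S.grad_welfare hC hU, grad_neg]
    ext (i | i | i | i | i) <;> simp [colC] <;> ring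
  rw [hblocks, dotProduct_colC, dotProduct_neg, dotProduct_neg, dotProduct_comm (cG (z - z')),
    dotProduct_comm (cL (z - z'))]
  simp only [dotProduct_zero, add_zero]
  rfl

/-- The states at which none of the terms of the dissipation rate of `H̄` loses energy: LaSalle's
principle is applied to solutions that stay in this set. -/
structure IsLossless (xbar x : State ng nl mc) : Prop where
  cG_eq : cG (S.zc x) = cG (S.zc xbar)
  cL_eq : cL (S.zc x) = cL (S.zc xbar)
  loadResidual_eq : S.loadResidual (grad (S.Hbar xbar) x) = 0
  xP_eq : xP (grad (S.Hbar xbar) x) = 0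
  xEg_eq : xEg (grad (S.Hbar xbar) x) = 0

namespace Regular

variable {S} {xbar x : State ng nl mc}

theorem posDef_Ag (hS : S.Regular) : S.Ag.PosDef := PosDef.diagonal fun _ => hS.A_pos _

theorem posDef_inv_Al (hS : S.Regular) : S.Al⁻¹.PosDef :=
  (PosDef.diagonal fun _ => hS.A_pos _).inv

theorem posDef_Rg (hS : S.Regular) : S.Rg.PosDef :=
  PosDef.diagonal fun i => div_pos (sub_pos.2 (hS.Xd_gt i)) (hS.T_pos i)

theorem differentiable_C (hS : S.Regular) : Differentiable ℝ S.C :=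
  hS.C_smooth.differentiable two_ne_zero

theorem differentiable_U (hS : S.Regular) : Differentiable ℝ S.U :=
  hS.U_smooth.differentiable two_ne_zero

theorem dissipation (hS : S.Regular) (hx : ∀ i, 0 < xE x i) :
    DAE.diffPart (grad (S.Hbar xbar) x) ⬝ᵥ (S.shiftedSystem xbar).f x ≤ 0 ∧
      (DAE.diffPart (grad (S.Hbar xbar) x) ⬝ᵥ (S.shiftedSystem xbar).f x = 0 →
        S.IsLossless xbar x) := by
  have hdC := hS.differentiable_C
  have hdU := hS.differentiable_U
  have hcost := grad_sub_dotProduct_nonneg_of_strictConvexOn hS.C_convex hdC (cG (S.zc x))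
    (cG (S.zc xbar))
  have hutility := grad_sub_dotProduct_nonneg_of_strictConvexOn hS.U_concave.neg hdU.neg
    (cL (S.zc x)) (cL (S.zc xbar))
  have hload := dotProduct_mulVec_nonneg_of_posDef hS.posDef_inv_Al
    (S.loadResidual (grad (S.Hbar xbar) x))
  have hgen := dotProduct_mulVec_nonneg_of_posDef hS.posDef_Ag (xP (grad (S.Hbar xbar) x))
  have hvolt := dotProduct_mulVec_nonneg_of_posDef hS.posDef_Rg (xEg (grad (S.Hbar xbar) x))
  have hrate := S.diffPart_grad_dotProduct_f xbar x
  simp only [hS.xC_grad_Hbar xbar hx, S.dotProduct_grad_welfare_sub hdC hdU] at hrate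
  refine ⟨by linarith, fun hzero => ⟨?_, ?_, ?_, ?_, ?_⟩⟩
  · exact eq_of_grad_sub_dotProduct_eq_zero hS.C_convex hdC (by linarith)
  · exact eq_of_grad_sub_dotProduct_eq_zero hS.U_concave.neg hdU.neg (by linarith)
  · exact eq_zero_of_dotProduct_mulVec_eq_zero hS.posDef_inv_Al (by linarith)
  · exact eq_zero_of_dotProduct_mulVec_eq_zero hS.posDef_Ag (by linarith)
  · exact eq_zero_of_dotProduct_mulVec_eq_zero hS.posDef_Rg (by linarith)

end Regular

end Model

theorem eq_zero_of_toRows_mulVec_eq_zero {m₁ m₂ n : Type*} [Fintype n]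
    {D : Matrix (m₁ ⊕ m₂) n ℝ} (hD : Function.Injective D.mulVec) {w : n → ℝ}
    (h₁ : D.toRows₁ *ᵥ w = 0) (h₂ : D.toRows₂ *ᵥ w = 0) : w = 0 := by
  refine hD ?_
  rw [mulVec_zero, ← fromRows_toRows D, fromRows_mulVec, h₁, h₂, Sum.elim_zero_zero]

namespace Model

variable {ng nl mc : ℕ} {S : Model ng nl mc} {xbar : State ng nl mc}

theorem state_eq_zero {h : State ng nl mc} (hC : xC h = 0) (hPhi : xPhi h = 0) (hP : xP h = 0)
    (hEg : xEg h = 0) (hEl : xEl h = 0) : h = 0 := by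
  ext ((i | i | i | i) | i)
  · exact congrFun hC i
  · exact congrFun hPhi i
  · exact congrFun hP i
  · exact congrFun hEg i
  · exact congrFun hEl i

theorem algebraic_iff {x : State ng nl mc} (hx : ∀ i, 0 < xE x i) :
    (S.shiftedSystem xbar).g x = 0 ↔ xEl (grad (S.Hbar xbar) x) = 0 := by
  simp only [shiftedSystem, neg_eq_zero, funext_iff, mulVec_diagonal, Pi.zero_apply, mul_eq_zero,
    (xEl_pos hx _).ne', false_or]

theorem Regular.xC_eq (hS : S.Regular) (x : State ng nl mc) :
    xC x = colC (S.τg *ᵥ cG (S.zc x)) (S.τl *ᵥ cL (S.zc x)) (S.τv *ᵥ cV (S.zc x))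
      (S.τlamg *ᵥ cLamG (S.zc x)) (S.τlaml *ᵥ cLamL (S.zc x)) := by
  rw [← hS.τc_mulVec_zc, S.τc_mulVec]

namespace IsLossless

theorem toRows₂_mulVec_eq_zero {x : State ng nl mc} (hl : S.IsLossless xbar x) (hS : S.Regular)
    (hx : ∀ i, 0 < xE x i) : S.Dhat.toRows₂ *ᵥ xPhi (grad (S.Hbar xbar) x) = 0 := by
  have hload := hl.loadResidual_eq
  have hcL : cL (S.zc x - S.zc xbar) = 0 := sub_eq_zero.2 hl.cL_eq
  rwa [loadResidual, hS.xC_grad_Hbar xbar hx, hcL, zero_add] at hload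

theorem f_eq {x : State ng nl mc} (hl : S.IsLossless xbar x) (hS : S.Regular)
    (hx : ∀ i, 0 < xE x i) :
    let w := S.zc x - S.zc xbar
    (S.shiftedSystem xbar).f x =
      colD
        (colC (cLamG w) (-cLamL w) (-(S.Dc.toRows₁ᵀ *ᵥ cLamG w) - S.Dc.toRows₂ᵀ *ᵥ cLamL w)
          (S.Dc.toRows₁ *ᵥ cV w) (S.Dc.toRows₂ *ᵥ cV w))
        0 (-(S.Dhat.toRows₁ *ᵥ xPhi (grad (S.Hbar xbar) x))) 0 := by
  have hcG : cG (S.zc x - S.zc xbar) = 0 := sub_eq_zero.2 hl.cG_eq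
  have hcL : cL (S.zc x - S.zc xbar) = 0 := sub_eq_zero.2 hl.cL_eq
  have hwelfare : grad S.welfare (S.zc x) = grad S.welfare (S.zc xbar) := by
    simp only [S.grad_welfare hS.differentiable_C hS.differentiable_U, hl.cG_eq, hl.cL_eq]
  simp only [shiftedSystem, Jc, hS.xC_grad_Hbar xbar hx, hl.xP_eq, hl.xEg_eq, hcG, hcL,
    hl.toRows₂_mulVec_eq_zero hS hx, hwelfare, colC_add, mulVec_zero, neg_zero, sub_self, add_zero,
    zero_add, zero_sub, sub_zero]

variable {x : ℝ → State ng nl mc}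

theorem cLamG_eq (hl : ∀ t ≥ 0, S.IsLossless xbar (x t)) (hS : S.Regular)
    (hx : (S.shiftedSystem xbar).IsSolutionOn (Ici 0) x) {t : ℝ} (ht : 0 ≤ t) :
    cLamG (S.zc (x t)) = cLamG (S.zc xbar) := by
  ext i
  have hconst : ∀ s ∈ Ici (0 : ℝ), x s (.inl (.inl (.inl i))) = (S.τg *ᵥ cG (S.zc xbar)) i := by
    intro s hs
    rw [← (hl s hs).cG_eq]
    exact congrFun (hS.xC_eq (x s)) (.inl i)
  have hf := hx.f_apply_eq_zero_of_const ht (uniqueDiffOn_Ici 0 t ht) hconst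
  rw [(hl t ht).f_eq hS (hx.mem_dom t ht)] at hf
  exact sub_eq_zero.1 hf

theorem cLamL_eq (hl : ∀ t ≥ 0, S.IsLossless xbar (x t)) (hS : S.Regular)
    (hx : (S.shiftedSystem xbar).IsSolutionOn (Ici 0) x) {t : ℝ} (ht : 0 ≤ t) :
    cLamL (S.zc (x t)) = cLamL (S.zc xbar) := by
  ext i
  have hconst : ∀ s ∈ Ici (0 : ℝ),
      x s (.inl (.inl (.inr (.inl i)))) = (S.τl *ᵥ cL (S.zc xbar)) i := by
    intro s hs
    rw [← (hl s hs).cL_eq]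
    exact congrFun (hS.xC_eq (x s)) (.inr (.inl i))
  have hf := hx.f_apply_eq_zero_of_const ht (uniqueDiffOn_Ici 0 t ht) hconst
  rw [(hl t ht).f_eq hS (hx.mem_dom t ht)] at hf
  exact sub_eq_zero.1 (neg_eq_zero.1 hf)

theorem cV_eq (hl : ∀ t ≥ 0, S.IsLossless xbar (x t)) (hS : S.Regular)
    (hinj : Function.Injective S.Dc.mulVec)
    (hx : (S.shiftedSystem xbar).IsSolutionOn (Ici 0) x) {t : ℝ} (ht : 0 ≤ t) :
    cV (S.zc (x t)) = cV (S.zc xbar) := by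
  have hf := (hl t ht).f_eq hS (hx.mem_dom t ht)
  refine sub_eq_zero.1 (eq_zero_of_toRows_mulVec_eq_zero hinj
    (w := cV (S.zc (x t) - S.zc xbar)) ?_ ?_)
  · ext i
    have hconst : ∀ s ∈ Ici (0 : ℝ), x s (.inl (.inl (.inr (.inr (.inr (.inl i)))))) =
        (S.τlamg *ᵥ cLamG (S.zc xbar)) i := by
      intro s hs
      rw [← cLamG_eq hl hS hx hs]
      exact congrFun (hS.xC_eq (x s)) (.inr (.inr (.inr (.inl i))))
    have hfi := hx.f_apply_eq_zero_of_const ht (uniqueDiffOn_Ici 0 t ht) hconst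
    rwa [hf] at hfi
  · ext i
    have hconst : ∀ s ∈ Ici (0 : ℝ), x s (.inl (.inl (.inr (.inr (.inr (.inr i)))))) =
        (S.τlaml *ᵥ cLamL (S.zc xbar)) i := by
      intro s hs
      rw [← cLamL_eq hl hS hx hs]
      exact congrFun (hS.xC_eq (x s)) (.inr (.inr (.inr (.inr i))))
    have hfi := hx.f_apply_eq_zero_of_const ht (uniqueDiffOn_Ici 0 t ht) hconst
    rwa [hf] at hfi

theorem zc_eq (hl : ∀ t ≥ 0, S.IsLossless xbar (x t)) (hS : S.Regular)
    (hinj : Function.Injective S.Dc.mulVec)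
    (hx : (S.shiftedSystem xbar).IsSolutionOn (Ici 0) x) {t : ℝ} (ht : 0 ≤ t) :
    S.zc (x t) = S.zc xbar := by
  ext (i | i | i | i | i)
  · exact congrFun (hl t ht).cG_eq i
  · exact congrFun (hl t ht).cL_eq i
  · exact congrFun (cV_eq hl hS hinj hx ht) i
  · exact congrFun (cLamG_eq hl hS hx ht) i
  · exact congrFun (cLamL_eq hl hS hx ht) i

theorem xPhi_grad_eq_zero (hl : ∀ t ≥ 0, S.IsLossless xbar (x t)) (hS : S.Regular)
    (hx : (S.shiftedSystem xbar).IsSolutionOn (Ici 0) x) {t : ℝ} (ht : 0 ≤ t) :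
    xPhi (grad (S.Hbar xbar) (x t)) = 0 := by
  have hpos := hx.mem_dom t ht
  refine eq_zero_of_toRows_mulVec_eq_zero hS.Dhat_injective ?_
    ((hl t ht).toRows₂_mulVec_eq_zero hS hpos)
  ext i
  have hconst : ∀ s ∈ Ici (0 : ℝ), x s (.inl (.inr (.inr (.inl i)))) = xP xbar i := by
    intro s hs
    have homega := (hl s hs).xP_eq
    rw [S.xP_grad_Hbar xbar (hx.mem_dom s hs)] at homega
    exact mul_left_cancel₀ (inv_ne_zero (hS.M_pos i).ne') (congrFun (sub_eq_zero.1 homega) i)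
  have hf := hx.f_apply_eq_zero_of_const ht (uniqueDiffOn_Ici 0 t ht) hconst
  rw [(hl t ht).f_eq hS hpos] at hf
  exact neg_eq_zero.1 hf

theorem grad_Hbar_eq_zero (hl : ∀ t ≥ 0, S.IsLossless xbar (x t)) (hS : S.Regular)
    (hinj : Function.Injective S.Dc.mulVec)
    (hx : (S.shiftedSystem xbar).IsSolutionOn (Ici 0) x) {t : ℝ} (ht : 0 ≤ t) :
    grad (S.Hbar xbar) (x t) = 0 := by
  have hpos := hx.mem_dom t ht
  refine state_eq_zero ?_ (xPhi_grad_eq_zero hl hS hx ht) (hl t ht).xP_eq (hl t ht).xEg_eq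
    ((algebraic_iff hpos).1 (hx.algebraic t ht))
  rw [hS.xC_grad_Hbar xbar hpos, zc_eq hl hS hinj hx ht, sub_self]

end IsLossless

end Model

/-! ### Equilibria of the closed loop -/

namespace Model

variable {ng nl mc : ℕ} (S : Model ng nl mc)

theorem statePart_join (x : State ng nl mc) (ωl : Fin nl → ℝ) : statePart (join x ωl) = x := by
  ext (i | i) <;> rfl

theorem freqPart_join (x : State ng nl mc) (ωl : Fin nl → ℝ) : freqPart (join x ωl) = ωl := rfl

theorem isOpen_dom (xbar : State ng nl mc) : IsOpen (S.shiftedSystem xbar).dom := by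
  have hdom : (S.shiftedSystem xbar).dom = ⋂ i, {x : State ng nl mc | 0 < xE x i} := by
    ext x
    simp only [shiftedSystem, mem_ofPred_eq, mem_iInter]
  rw [hdom]
  refine isOpen_iInter_of_finite fun i => ?_
  rcases i with i | i <;> exact isOpen_lt continuous_const (continuous_apply _)

theorem contDiffAt_f {xbar : State ng nl mc} (hC : ContDiff ℝ 2 S.C) (hU : ContDiff ℝ 2 S.U)
    (hx : ∀ i, 0 < xE xbar i) : ContDiffAt ℝ 1 (S.shiftedSystem xbar).f xbar := by
  have hgrad : ContDiffAt ℝ 1 (grad (S.Hbar xbar)) xbar :=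
    contDiffAt_grad (S.contDiffAt_Hbar xbar hx (n := 2)) one_add_one_eq_two.le
  have hwelfare : ContDiff ℝ 1 fun x => grad S.welfare (S.zc x) :=
    (contDiff_iff_contDiffAt.2 fun z =>
      contDiffAt_grad (S.contDiff_welfare hC hU).contDiffAt one_add_one_eq_two.le).comp
        S.contDiff_zc
  have hfield : ContDiff ℝ 1 fun p : State ng nl mc × (CIdx ng nl mc → ℝ) =>
      colD (S.Jc (xC p.1) + colC (-xP p.1)
          (-((S.Al)⁻¹ *ᵥ cL (xC p.1)) - (S.Al)⁻¹ *ᵥ (S.Dhat.toRows₂ *ᵥ xPhi p.1)) 0 0 0 +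
          (p.2 - grad S.welfare (S.zc xbar)))
        (-(S.Dhat.toRows₂ᵀ *ᵥ ((S.Al)⁻¹ *ᵥ cL (xC p.1))) -
          S.Dhat.toRows₂ᵀ *ᵥ ((S.Al)⁻¹ *ᵥ (S.Dhat.toRows₂ *ᵥ xPhi p.1)) +
          S.Dhat.toRows₁ᵀ *ᵥ xP p.1)
        (cG (xC p.1) - S.Dhat.toRows₁ *ᵥ xPhi p.1 - S.Ag *ᵥ xP p.1)
        (-(S.Rg *ᵥ xEg p.1)) := by
    refine contDiff_pi.2 fun j => ?_
    rcases j with (i | i | i | i | i) | i | i | i <;>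
    · simp only [colD, colC, Jc, Sum.elim_inl, Sum.elim_inr, Pi.add_apply, Pi.sub_apply,
        Pi.neg_apply, Pi.zero_apply, mulVec, dotProduct, cG, cL, cV, cLamG, cLamL, xC, xPhi, xP,
        xEg]
      fun_prop
  exact hfield.contDiffAt.comp xbar (hgrad.prodMk hwelfare.contDiffAt)

/-- The equations of an equilibrium of the closed-loop system, apart from those of the voltages,
in terms of `z = z_c`, of the frequency deviations `ω_g` and `ω_l`, and of `η = ∇_φ H_p`. -/
structure IsSteady (z : CIdx ng nl mc → ℝ) (ωg : Fin ng → ℝ) (ωl : Fin nl → ℝ)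
    (η : Fin (ng + nl - 1) → ℝ) : Prop where
  cost : cLamG z - ωg - grad S.C (cG z) = 0
  utility : -cLamL z + ωl + grad S.U (cL z) = 0
  price : -(S.Dc.toRows₁ᵀ *ᵥ cLamG z) - S.Dc.toRows₂ᵀ *ᵥ cLamL z = 0
  balance_g : -cG z + S.Dc.toRows₁ *ᵥ cV z = 0
  balance_l : cL z + S.Dc.toRows₂ *ᵥ cV z = 0
  angle : S.Dhat.toRows₁ᵀ *ᵥ ωg + S.Dhat.toRows₂ᵀ *ᵥ ωl = 0
  power_g : cG z - S.Dhat.toRows₁ *ᵥ η - S.Ag *ᵥ ωg = 0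
  power_l : -cL z - S.Dhat.toRows₂ *ᵥ η - S.Al *ᵥ ωl = 0

variable {S}

theorem transpose_Dc_mulVec_eq_zero
    (hker : LinearMap.ker (S.Dhatᵀ).mulVecLin = Submodule.span ℝ {fun _ => (1 : ℝ)})
    (hone : (S.Dcᵀ *ᵥ fun _ => 1) = 0) {u : Bus ng nl → ℝ} (hu : S.Dhatᵀ *ᵥ u = 0) :
    S.Dcᵀ *ᵥ u = 0 := by
  have hspan : u ∈ Submodule.span ℝ {fun _ => (1 : ℝ)} := hker.le hu
  obtain ⟨a, rfl⟩ := Submodule.mem_span_singleton.1 hspan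
  rw [mulVec_smul, hone, smul_zero]

namespace IsSteady

variable {z : CIdx ng nl mc → ℝ} {ωg : Fin ng → ℝ} {ωl : Fin nl → ℝ} {η : Fin (ng + nl - 1) → ℝ}

theorem Dc_mulVec_cV (h : S.IsSteady z ωg ωl η) :
    S.Dc *ᵥ cV z = S.Dhat *ᵥ η + diagonal S.A *ᵥ Sum.elim ωg ωl := by
  have hg := (add_eq_zero_iff_neg_eq.1 h.balance_g).symm.trans (neg_neg (cG z))
  have hl := (add_eq_zero_iff_neg_eq.1 h.balance_l).symm
  have hpg := h.power_g
  have hpl := h.power_l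
  rw [← hl, sub_sub, sub_eq_zero] at hpl
  rw [← hg, sub_sub, sub_eq_zero] at hpg
  rw [← fromRows_toRows S.Dc, fromRows_mulVec, hpg, hpl, Sum.elim_add_add, ← fromRows_mulVec,
    fromRows_toRows]
  congr 1
  ext (i | i) <;> simp only [Ag, Al, mulVec_diagonal, Sum.elim_inl, Sum.elim_inr]

theorem omega_eq_zero (h : S.IsSteady z ωg ωl η) (hA : ∀ i, 0 < S.A i)
    (hker : ∀ u, S.Dhatᵀ *ᵥ u = 0 → S.Dcᵀ *ᵥ u = 0) : ωg = 0 ∧ ωl = 0 := by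
  set ω : Bus ng nl → ℝ := Sum.elim ωg ωl with hω
  have hangle : S.Dhatᵀ *ᵥ ω = 0 := by
    rw [← fromRows_toRows S.Dhat, transpose_fromRows, fromCols_mulVec, ← h.angle]
    rfl
  have hDhat : ω ⬝ᵥ (S.Dhat *ᵥ η) = 0 := by
    rw [← dotProduct_transpose_mulVec, hangle, dotProduct_zero]
  have hDc : ω ⬝ᵥ (S.Dc *ᵥ cV z) = 0 := by
    rw [← dotProduct_transpose_mulVec, hker ω hangle, dotProduct_zero]
  have hzero : ω = 0 := by
    refine eq_zero_of_dotProduct_mulVec_eq_zero (PosDef.diagonal hA) ?_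
    rwa [h.Dc_mulVec_cV, dotProduct_add, hDhat, zero_add] at hDc
  rwa [hω, ← Sum.elim_zero_zero, Sum.elim_eq_iff] at hzero

theorem kkt (h : S.IsSteady z 0 0 η) : S.KKT (cG z) (cL z) (cV z) (cLamG z) (cLamL z) where
  cost := by rw [← neg_eq_zero, neg_sub, ← sub_zero (cLamG z), h.cost]
  utility := by rw [← neg_eq_zero, neg_add, neg_neg, add_comm, ← add_zero (-cLamL z), h.utility]
  price := by rw [← neg_eq_zero, neg_add', h.price]
  balance_g := by rw [← neg_eq_zero, neg_add, neg_neg, add_comm, h.balance_g]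
  balance_l := by rw [← neg_eq_zero, neg_sub, sub_neg_eq_add, h.balance_l]

end IsSteady

variable {xbar : State ng nl mc} {ωl : Fin nl → ℝ}

theorem grad_Hp_add_Hc (x : State ng nl mc) :
    grad (fun x => S.Hp x + S.Hc x) x = grad S.Hp x + grad S.Hc x :=
  grad_add (S.contDiff_Hp.differentiable one_ne_zero x)
    (S.contDiff_Hc.differentiable one_ne_zero x)

theorem xE_pos_of_isEquilibrium (heq : S.closedLoop.IsEquilibrium (join xbar ωl)) (i : Bus ng nl) :
    0 < xE xbar i := by
  have hdom : ∀ i, 0 < xE (statePart (join xbar ωl)) i := heq.1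
  rw [statePart_join] at hdom
  exact hdom i

namespace Regular

theorem isSteady (hS : S.Regular) (heq : S.closedLoop.IsEquilibrium (join xbar ωl)) :
    S.IsSteady (S.zc xbar) (S.omegaG xbar) ωl (xPhi (grad S.Hp xbar)) := by
  obtain ⟨-, hf, hg⟩ := heq
  have hC : xC (grad S.Hp xbar + grad S.Hc xbar) = S.zc xbar := by
    rw [← hS.xC_grad_Hc, ← zero_add (xC (grad S.Hc xbar)), ← S.xC_grad_Hp xbar]
    rfl
  have hP : xP (grad S.Hp xbar + grad S.Hc xbar) = S.omegaG xbar := by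
    rw [← S.xP_grad_Hp]
    ext i
    simp [xP, S.grad_Hc_apply_eq_zero]
  have hPhi : xPhi (grad S.Hp xbar + grad S.Hc xbar) = xPhi (grad S.Hp xbar) := by
    ext i
    simp [xPhi, S.grad_Hc_apply_eq_zero]
  simp only [closedLoop, statePart_join, freqPart_join, grad_Hp_add_Hc, hC, hP, hPhi, Jc,
    S.grad_welfare hS.differentiable_C hS.differentiable_U, colC_add, colD_eq_zero_iff,
    colC_eq_zero_iff, add_zero, ← sub_eq_add_neg] at hf
  simp only [closedLoop, statePart_join, freqPart_join, grad_Hp_add_Hc, hC, hPhi,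
    ← Sum.elim_zero_zero, Sum.elim_eq_iff] at hg
  obtain ⟨⟨hcost, hutility, hprice, hbalance_g, hbalance_l⟩, hangle, hpower_g, -⟩ := hf
  exact ⟨hcost, hutility, hprice, hbalance_g, hbalance_l, hangle, hpower_g, hg.2⟩

theorem grad_Hbar_self (hS : S.Regular) (heq : S.closedLoop.IsEquilibrium (join xbar ωl)) :
    grad (S.Hbar xbar) xbar = 0 := by
  have hx := xE_pos_of_isEquilibrium heq
  refine state_eq_zero ?_ ?_ ?_ ?_ ?_
  · rw [hS.xC_grad_Hbar xbar hx, sub_self]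
  · rw [S.xPhi_grad_Hbar xbar hx, sub_self]
  · rw [S.xP_grad_Hbar xbar hx, sub_self]
  · rw [S.xEg_grad_Hbar xbar hx, sub_self]
  · ext i
    have hg := congrFun heq.2.2 (.inl i)
    simp only [closedLoop, statePart_join, grad_Hp_add_Hc, Sum.elim_inl, Pi.add_apply,
      Pi.neg_apply, mulVec_diagonal, Pi.zero_apply, xEl, Pi.add_apply,
      S.grad_Hc_apply_eq_zero xbar (j := .inr i) (by simp)] at hg
    rw [S.xEl_grad_Hbar xbar hx, Pi.zero_apply, sub_eq_zero, eq_div_iff (xEl_pos hx i).ne']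
    simp only [xEl]
    linarith

theorem isEquilibrium_shiftedSystem (hS : S.Regular)
    (heq : S.closedLoop.IsEquilibrium (join xbar ωl)) :
    (S.shiftedSystem xbar).IsEquilibrium xbar := by
  have hx := xE_pos_of_isEquilibrium heq
  have hgrad := hS.grad_Hbar_self heq
  have hlossless : S.IsLossless xbar xbar := by
    refine ⟨rfl, rfl, ?_, ?_, ?_⟩ <;> rw [hgrad]
    · exact (zero_add _).trans (mulVec_zero _)
    · rfl
    · rfl
  refine ⟨hx, ?_, (algebraic_iff hx).2 (by rw [hgrad]; rfl)⟩
  have hPhi : xPhi (0 : State ng nl mc) = 0 := rfl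
  have hG : cLamG (0 : CIdx ng nl mc → ℝ) = 0 := rfl
  have hL : cLamL (0 : CIdx ng nl mc → ℝ) = 0 := rfl
  have hV : cV (0 : CIdx ng nl mc → ℝ) = 0 := rfl
  simp only [hlossless.f_eq hS hx, hgrad, sub_self, hPhi, hG, hL, hV, mulVec_zero, neg_zero,
    colC_eq_zero_iff, colD_eq_zero_iff, and_self]

end Regular

end Model

end

theorem theorem2_general {ng nl mc : ℕ} (S : Model ng nl mc) (hS : S.Regular)
    (hker : LinearMap.ker (S.Dhatᵀ).mulVecLin = Submodule.span ℝ {fun _ => (1 : ℝ)})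
    (hinj : Function.Injective S.Dc.mulVec) (hone : (S.Dcᵀ *ᵥ fun _ => 1) = 0)
    (xbar : State ng nl mc) (ωl : Fin nl → ℝ)
    (heq : S.closedLoop.IsEquilibrium (Model.join xbar ωl))
    (hH : (hess (S.Hbar xbar) xbar).PosDef) :
    (S.shiftedSystem xbar).LocallyAsymptoticallyStable xbar ∧
    S.omegaG xbar = 0 ∧ ωl = 0 ∧
    S.KKT (cG (S.zc xbar)) (cL (S.zc xbar)) (cV (S.zc xbar)) (cLamG (S.zc xbar))
      (cLamL (S.zc xbar)) := by
  have hx := Model.xE_pos_of_isEquilibrium heq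
  obtain ⟨r, c, K, hlyap⟩ := DAE.exists_lyapunovOn
    (hdom := (S.isOpen_dom xbar).mem_nhds hx)
    (hH := S.contDiffAt_Hbar xbar hx)
    (hf := S.contDiffAt_f hS.C_smooth hS.U_smooth hx)
    (hess_pos := hH)
    (grad_eq_zero := hS.grad_Hbar_self heq)
    (algebraic_iff := fun _ hx => (Model.algebraic_iff hx).trans funext_iff)
    (dissipation := fun _ hx => (hS.dissipation hx.1).1)
    (detectable := fun _ hx h0 => Model.IsLossless.grad_Hbar_eq_zero
      (fun t ht => (hS.dissipation (hx.mem_dom t ht)).2 (h0 t ht)) hS hinj hx le_rfl)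
  have hsteady := hS.isSteady heq
  obtain ⟨hωg, hωl⟩ := hsteady.omega_eq_zero hS.A_pos fun _ =>
    Model.transpose_Dc_mulVec_eq_zero hker hone
  rw [hωg, hωl] at hsteady
  exact ⟨hlyap.locallyAsymptoticallyStable (hS.isEquilibrium_shiftedSystem heq), hωg, hωl,
    hsteady.kkt⟩

theorem theorem2 {ng nl : ℕ} (S : Model ng nl (ng + nl - 1)) (hS : S.Standing)
    (hDc : IsTreeIncidence S.Dc)
    (xbar : State ng nl (ng + nl - 1)) (ωl : Fin nl → ℝ)
    (heq : S.closedLoop.IsEquilibrium (Model.join xbar ωl))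
    (hH : (hess (S.Hbar xbar) xbar).PosDef) :
    (S.shiftedSystem xbar).LocallyAsymptoticallyStable xbar ∧
    S.omegaG xbar = 0 ∧ ωl = 0 ∧
    S.KKT (cG (S.zc xbar)) (cL (S.zc xbar)) (cV (S.zc xbar)) (cLamG (S.zc xbar))
      (cLamL (S.zc xbar)) := by
  exact theorem2_general S hS.regular hS.Dhat_ker hDc.mulVec_injective
    ((hDc.transpose_mulVec_eq_zero_iff _).2 fun _ _ => rfl) xbar ωl heq hH
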